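/- Let $N\ge 3$ and $k\ge 1$ be integers, $2^*=\frac{2N}{N-2}$, and let $D^{1,2}(\mathbb R^N)$ be the space of all $u\in L^{2^*}(\mathbb R^N)$ whose weak gradient satisfies $|\nabla u|\in L^2(\mathbb R^N)$. Let $A=(a_{ij})_{i,j=1,\dots,k}$ be an invertible symmetric real matrix and write $A^{-1}=(a^{-1}_{ij})_{i,j=1,\dots,k}$ for its inverse. Let $H_1,\dots,H_k:\mathbb R^N\to\mathbb R$ be smooth functions with $H_i\in L^{2^*}(\mathbb R^N)$ and $|x|H_i\in L^2(\mathbb R^N)$ for every $i$. Suppose that $u_1,\dots,u_k\in D^{1,2}(\mathbb R^N)$ are positive almost everywhere and are weak solutions of $$-\Delta u_i=\sum_{j=1}^k a_{ij}\,u_j^{2^*-1}+H_i\quad\text{in }\mathbb R^N,\qquad i=1,\dots,k,$$ that is, $\int_{\mathbb R^N}\nabla u_i\cdot\nabla\varphi\,dx=\int_{\mathbb R^N}\bigl(\sum_{j}a_{ij}u_j^{2^*-1}+H_i\bigr)\varphi\,dx$ for all $\varphi\in C_c^\infty(\mathbb R^N)$ and all $i$. Then for all $i,j$ the function $H_i\bigl(x\cdot\nabla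 u_j+\frac{N-2}{2}u_j\bigr)$ is integrable on $\mathbb R^N$, and $$0=\sum_{i,j=1}^k a^{-1}_{ij}\int_{\mathbb R^N}H_i(x)\Bigl(x\cdot\nabla u_j+\frac{N-2}{2}\,u_j\Bigr)\,dx .$$ -/

import Mathlib

open MeasureTheory
open scoped ContDiff

/-- The critical Sobolev exponent `2^* = 2N / (N - 2)`, as a real number (meaningful for `N ≥ 3`). -/
noncomputable def critExp (N : ℕ) : ℝ := 2 * (N : ℝ) / ((N : ℝ) - 2)

/-- `G` is the weak (distributional) gradient of `u` on `ℝ^N`: both are locally integrable and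
`∫ u ∂_v φ = - ∫ (G · v) φ` for every test function `φ ∈ C_c^∞(ℝ^N)` and every direction `v`. -/
structure HasWeakGradient {N : ℕ} (u : EuclideanSpace ℝ (Fin N) → ℝ)
    (G : EuclideanSpace ℝ (Fin N) → EuclideanSpace ℝ (Fin N)) : Prop where
  locallyIntegrable : LocallyIntegrable u volume
  locallyIntegrable_grad : LocallyIntegrable G volume
  integral_eq : ∀ φ : EuclideanSpace ℝ (Fin N) → ℝ, ContDiff ℝ ∞ φ → HasCompactSupport φ →
    ∀ v : EuclideanSpace ℝ (Fin N),
      ∫ x, u x * fderiv ℝ φ x v = - ∫ x, inner ℝ (G x) v * φ x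

/-- `u ∈ D^{1,2}(ℝ^N)`, with weak gradient `Du`: `u ∈ L^{2^*}` and `|∇u| ∈ L^2`. The weak gradient
is unique up to null sets. -/
structure MemD12 {N : ℕ} (u : EuclideanSpace ℝ (Fin N) → ℝ)
    (Du : EuclideanSpace ℝ (Fin N) → EuclideanSpace ℝ (Fin N)) : Prop where
  memLp : MemLp u (ENNReal.ofReal (critExp N)) volume
  hasWeakGradient : HasWeakGradient u Du
  memLp_grad : MemLp Du 2 volume

/-- A function with weak gradient `Du` is a weak solution of `-Δ u = f` on `ℝ^N`: the right-hand
side is locally integrable and `∫ ∇u · ∇φ = ∫ f φ` for every `φ ∈ C_c^∞(ℝ^N)`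
(here `fderiv ℝ φ x (Du x) = ∇φ(x) · ∇u(x)`). -/
structure IsWeakPoissonSolution {N : ℕ}
    (Du : EuclideanSpace ℝ (Fin N) → EuclideanSpace ℝ (Fin N))
    (f : EuclideanSpace ℝ (Fin N) → ℝ) : Prop where
  locallyIntegrable : LocallyIntegrable f volume
  integral_eq : ∀ φ : EuclideanSpace ℝ (Fin N) → ℝ, ContDiff ℝ ∞ φ → HasCompactSupport φ →
    ∫ x, fderiv ℝ φ x (Du x) = ∫ x, f x * φ x

section
open Filter Topology Set
open scoped ENNReal NNReal Convolution

/-! This is a Pohozaev identity, classically obtained by multiplying the equations by `x · ∇u_j`.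
Since `u_j` has only a weak gradient in `L^2`, difference quotients of dilations replace that
multiplier. Put `c = (N-2)/2` and `u_s(x) = e^{cs} u(e^s x)`. These dilations preserve `∫ |u|^{2^*}`
and act on gradients as unitary operators of `L^2`; the generator is `x · ∇u + c u`.

Test the `i`-th equation with `u_{j,s} - u_j` and sum against `A⁻¹ i j`. The matrix cancels in the
nonlinear part, leaving `∑ j, ∫ u_j^{2^*-1} (u_{j,s} - u_j)`, the first variation of a
dilation-invariant integral. By unitarity and the symmetry of `A⁻¹`, the gradient part equals `-1/2`
times a quadratic form in the differences of the gradients. Hence `Z(s) = ∑ A⁻¹ i j ∫ H_i (u_{j,s} -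
u_j)` is bounded by `C Q(s) + P(s)`, with `Q` the sum of the squared `L^2` norms of the gradient
differences and `P` the sum of the integrals of `powDiff` (`abs_sum_inv_mul_integral_le`). As
`Z(s)/s` tends to the sum in question, it remains to prove `Q, P = o(s)`.

Two estimates give this. First, `P ≤ ε Q + K s²` (`sum_sum_powDiff_le`): the potential `u^{2^*-2}`
lies in `L^{N/2}`, so it is a small `L^{N/2}` part plus a part below a multiple of `|x|^{-2}`;
Sobolev controls the former by `ε Q`, and `(u_s - u)/|x| = O(s)` in `L^2`, a Hardy-type bound,
controls the latter. Second, testing with `(u_{i,s} - u_i) + (u_{i,-s} - u_i)` gives `Q ≤ a P + R`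
(`sum_gradDiffNorm_sq_le`), where `R` holds the symmetric second differences of `∫ H_i u_i`. These
are `o(s)` because the quotients at `s` and `-s` have the same limit. Absorbing `ε Q` yields `Q =
O(s²) + O(R) = o(s)`. -/

/-- Euclidean space `ℝ^N`. -/
abbrev Euc (N : ℕ) := EuclideanSpace ℝ (Fin N)

/-- The dilation `x ↦ e^{as} f(e^s x)` of `f` with weight `a`. -/
noncomputable def dil {N : ℕ} {F : Type*} [SMul ℝ F] (a s : ℝ) (f : Euc N → F) : Euc N → F :=
  fun x => Real.exp (a * s) • f (Real.exp s • x)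

/-! ### Dilations: scale invariance and duality. -/

section Dilation

variable {N : ℕ} {F : Type*} [NormedAddCommGroup F] [NormedSpace ℝ F]

theorem dil_apply (a s : ℝ) (f : Euc N → F) (x : Euc N) :
    dil a s f x = Real.exp (a * s) • f (Real.exp s • x) := rfl

theorem dil_zero (a : ℝ) (f : Euc N → F) : dil a 0 f = f := by
  ext x; simp [dil]

theorem dil_dil (a s t : ℝ) (f : Euc N → F) : dil a s (dil a t f) = dil a (s + t) f := by
  funext x
  simp only [dil, smul_smul, ← Real.exp_add]
  congr 2 <;> ring_nf

theorem dil_sub (a s : ℝ) (f g : Euc N → F) : dil a s (f - g) = dil a s f - dil a s g := by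
  funext x; simp [dil, smul_sub]

theorem quasiMeasurePreserving_exp_smul (s : ℝ) :
    Measure.QuasiMeasurePreserving (fun x : Euc N => Real.exp s • x) volume volume :=
  Measure.quasiMeasurePreserving_smul volume (Real.exp_pos s).ne'

theorem ae_exp_smul {P : Euc N → Prop} (h : ∀ᵐ x, P x) (s : ℝ) : ∀ᵐ x : Euc N, P (Real.exp s • x) :=
  (quasiMeasurePreserving_exp_smul s).ae h

theorem aestronglyMeasurable_dil {f : Euc N → F} (hf : AEStronglyMeasurable f volume) (a s : ℝ) :
    AEStronglyMeasurable (dil a s f) volume :=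
  (hf.comp_quasiMeasurePreserving (quasiMeasurePreserving_exp_smul s)).const_smul _

theorem lintegral_comp_smul_pos (f : Euc N → ℝ≥0∞) {r : ℝ} (hr : 0 < r) :
    ∫⁻ x, f (r • x) = ENNReal.ofReal ((r ^ N)⁻¹) * ∫⁻ x, f x := by
  have e : MeasurableEmbedding (fun x : Euc N => r • x) :=
    (Homeomorph.smulOfNeZero r hr.ne').measurableEmbedding
  rw [← e.lintegral_map, Measure.map_addHaar_smul _ hr.ne', lintegral_smul_measure,
    finrank_euclideanSpace_fin, abs_of_pos (by positivity), smul_eq_mul]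

theorem integral_dil (f : Euc N → F) (s : ℝ) : ∫ x, dil (N : ℝ) s f x = ∫ x, f x := by
  simp only [dil]
  rw [integral_smul, Measure.integral_comp_smul_of_nonneg volume f (Real.exp s)
    (hR := (Real.exp_pos s).le), smul_smul, finrank_euclideanSpace_fin, ← Real.exp_nat_mul,
    mul_inv_cancel₀ (Real.exp_pos _).ne', one_smul]

theorem integrable_dil {f : Euc N → F} (hf : Integrable f volume) (a s : ℝ) :
    Integrable (dil a s f) volume :=
  (hf.comp_smul (Real.exp_pos s).ne').smul _

/-- The factor `e^{asp}` cancels the Jacobian `e^{-Ns}` exactly when `a p = N`. The pairs used are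
`(N/2, 2)` for gradients and for `u/|x|`, and `(1, N)` for gradients of cutoffs. -/
theorem eLpNorm_dil (f : Euc N → F) {a s : ℝ} {p : ℝ≥0∞} (hp0 : p ≠ 0) (hp : p ≠ ⊤)
    (h : a * p.toReal = N) : eLpNorm (dil a s f) p volume = eLpNorm f p volume := by
  have hpos : 0 < p.toReal := ENNReal.toReal_pos hp0 hp
  rw [eLpNorm_eq_lintegral_rpow_enorm_toReal hp0 hp, eLpNorm_eq_lintegral_rpow_enorm_toReal hp0 hp]
  congr 1
  have : ∀ x, ‖dil a s f x‖ₑ ^ p.toReal =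
      ENNReal.ofReal (Real.exp s ^ N) * ‖f (Real.exp s • x)‖ₑ ^ p.toReal := by
    intro x
    rw [dil_apply, enorm_smul, ENNReal.mul_rpow_of_nonneg _ _ hpos.le,
      Real.enorm_of_nonneg (Real.exp_pos _).le, ENNReal.ofReal_rpow_of_pos (Real.exp_pos _),
      ← Real.exp_mul, ← Real.exp_nat_mul, ← h]
    congr 3; ring
  simp_rw [this]
  rw [lintegral_const_mul' _ _ ENNReal.ofReal_ne_top,
    lintegral_comp_smul_pos (fun x => ‖f x‖ₑ ^ p.toReal) (Real.exp_pos s), ← mul_assoc,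
    ← ENNReal.ofReal_mul (by positivity), mul_inv_cancel₀ (by positivity), ENNReal.ofReal_one,
    one_mul]

theorem memLp_dil {f : Euc N → F} {a s : ℝ} {p : ℝ≥0∞} (hp0 : p ≠ 0) (hp : p ≠ ⊤)
    (h : a * p.toReal = N) (hf : MemLp f p volume) : MemLp (dil a s f) p volume :=
  ⟨aestronglyMeasurable_dil hf.1 a s, by rw [eLpNorm_dil f hp0 hp h]; exact hf.2⟩

theorem dil_mul (a b s : ℝ) (f g : Euc N → ℝ) :
    (fun x => dil a s f x * dil b s g x) = dil (a + b) s (fun x => f x * g x) := by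
  funext x
  simp only [dil, smul_eq_mul, add_mul, Real.exp_add]; ring

/-- The substitution `x ↦ e^{-s} x`: complementary weights make `dil a s` and `dil b (-s)` adjoint.
-/
theorem integral_dil_mul {a b : ℝ} (s : ℝ) (hab : a + b = N) (f g : Euc N → ℝ) :
    ∫ x, dil a s f x * g x = ∫ x, f x * dil b (-s) g x := by
  have : (fun x => dil a s f x * g x) = dil N s (fun x => f x * dil b (-s) g x) := by
    rw [← hab, ← dil_mul, dil_dil]; simp [dil_zero]
  rw [this, integral_dil]

theorem integrable_dil_mul {a b : ℝ} (s : ℝ) (hab : a + b = N) {f g : Euc N → ℝ} :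
    Integrable (fun x => dil a s f x * g x) volume ↔
      Integrable (fun x => f x * dil b (-s) g x) volume := by
  have h1 : (fun x => dil a s f x * g x) = dil N s (fun x => f x * dil b (-s) g x) := by
    rw [← hab, ← dil_mul, dil_dil]; simp [dil_zero]
  refine ⟨fun h => ?_, fun h => h1 ▸ integrable_dil h _ _⟩
  have := integrable_dil h N (-s)
  rwa [h1, dil_dil, neg_add_cancel, dil_zero] at this

theorem inv_norm_mul_dil (s c : ℝ) (u : Euc N → ℝ) :
    (fun x => ‖x‖⁻¹ * dil c s u x) = dil (c + 1) s (fun x => ‖x‖⁻¹ * u x) := by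
  funext x
  simp only [dil, smul_eq_mul, norm_smul, Real.norm_eq_abs, abs_of_pos (Real.exp_pos s), mul_inv,
    add_mul, Real.exp_add, one_mul]
  have := (Real.exp_pos s).ne'
  field_simp

end Dilation

/-! ### Integration along rays, the source of the Hardy-type bounds. -/

section Ray

variable {N : ℕ}

/-- Cauchy–Schwarz on each ray with weight `s^{3/2}`, then Tonelli and the scaling `∫ g(sx)² dx =
s^{-N} ∫ g²`. On `(1, ∞)` both weight integrals converge as soon as `N ≥ 3`. -/
theorem lintegral_ray_le {g : Euc N → ℝ≥0∞} (hg : Measurable g) {I : Set ℝ}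
    (hI : MeasurableSet I) (hpos : I ⊆ Ioi 0) :
    ∫⁻ x, (∫⁻ s in I, g (s • x)) ^ (2 : ℝ) ≤
      (∫⁻ s in I, ENNReal.ofReal (s ^ (-(3 / 2) : ℝ))) *
      (∫⁻ s in I, ENNReal.ofReal (s ^ (3 / 2 : ℝ) * (s ^ N)⁻¹)) * ∫⁻ x, g x ^ (2 : ℝ) := by
  have hgm : Measurable (fun p : Euc N × ℝ => g (p.2 • p.1)) :=
    hg.comp (measurable_snd.smul measurable_fst)
  have key : ∀ x, (∫⁻ s in I, g (s • x)) ^ (2 : ℝ) ≤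
      (∫⁻ s in I, ENNReal.ofReal (s ^ (-(3 / 2) : ℝ))) *
        ∫⁻ s in I, ENNReal.ofReal (s ^ (3 / 2 : ℝ)) * g (s • x) ^ (2 : ℝ) := by
    intro x
    -- The factors `s^{∓3/4}` square to the weights `s^{∓3/2}`.
    have h1 : ∫⁻ s in I, g (s • x) = ∫⁻ s in I, ((fun s : ℝ => ENNReal.ofReal (s ^ (-(3 / 4) : ℝ))) *
        fun s : ℝ => ENNReal.ofReal (s ^ (3 / 4 : ℝ)) * g (s • x)) s := by
      refine setLIntegral_congr_fun hI fun s hs => ?_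
      have hs' : 0 < s := hpos hs
      simp only [Pi.mul_apply]
      rw [← mul_assoc, ← ENNReal.ofReal_mul (by positivity), ← Real.rpow_add hs']
      norm_num
    have h2 := ENNReal.lintegral_mul_le_Lp_mul_Lq (volume.restrict I) Real.HolderConjugate.two_two
      (f := fun s : ℝ => ENNReal.ofReal (s ^ (-(3 / 4) : ℝ)))
      (g := fun s : ℝ => ENNReal.ofReal (s ^ (3 / 4 : ℝ)) * g (s • x))
      (by fun_prop) (by
        have : Measurable (fun s : ℝ => g (s • x)) := hgm.comp (by fun_prop : Measurable fun s : ℝ => (x, s))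
        fun_prop)
    rw [h1]
    refine (ENNReal.rpow_le_rpow h2 (by norm_num)).trans (le_of_eq ?_)
    rw [ENNReal.mul_rpow_of_nonneg _ _ (by norm_num), ← ENNReal.rpow_mul, ← ENNReal.rpow_mul]
    norm_num
    congr 1
    · refine setLIntegral_congr_fun hI fun s hs => ?_
      have hs' : 0 < s := hpos hs
      rw [← ENNReal.ofReal_pow (by positivity), ← Real.rpow_natCast, ← Real.rpow_mul hs'.le]
      norm_num
    · refine setLIntegral_congr_fun hI fun s hs => ?_
      have hs' : 0 < s := hpos hs
      rw [mul_pow, ← ENNReal.ofReal_pow (by positivity), ← Real.rpow_natCast, ← Real.rpow_mul hs'.le]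
      norm_num
  calc _ ≤ ∫⁻ x, (∫⁻ s in I, ENNReal.ofReal (s ^ (-(3 / 2) : ℝ))) *
        ∫⁻ s in I, ENNReal.ofReal (s ^ (3 / 2 : ℝ)) * g (s • x) ^ (2 : ℝ) := lintegral_mono key
    _ = (∫⁻ s in I, ENNReal.ofReal (s ^ (-(3 / 2) : ℝ))) *
        ∫⁻ x : Euc N, ∫⁻ s in I, ENNReal.ofReal (s ^ (3 / 2 : ℝ)) * g (s • x) ^ (2 : ℝ) := by
      rw [lintegral_const_mul]
      exact Measurable.lintegral_prod_right' (f := fun p : Euc N × ℝ =>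
        ENNReal.ofReal (p.2 ^ (3 / 2 : ℝ)) * g (p.2 • p.1) ^ (2 : ℝ)) (by fun_prop)
    _ = (∫⁻ s in I, ENNReal.ofReal (s ^ (-(3 / 2) : ℝ))) *
        ∫⁻ s in I, ∫⁻ x : Euc N, ENNReal.ofReal (s ^ (3 / 2 : ℝ)) * g (s • x) ^ (2 : ℝ) := by
      rw [lintegral_lintegral_swap]
      exact (Measurable.aemeasurable (by fun_prop) : AEMeasurable (fun p : Euc N × ℝ =>
        ENNReal.ofReal (p.2 ^ (3 / 2 : ℝ)) * g (p.2 • p.1) ^ (2 : ℝ)) _)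
    _ = _ := by
      rw [mul_assoc, ← lintegral_mul_const (μ := volume.restrict I) (∫⁻ x, g x ^ (2 : ℝ)) (by fun_prop)]
      congr 1
      refine setLIntegral_congr_fun hI fun s hs => ?_
      have hs' : 0 < s := hpos hs
      rw [lintegral_const_mul' _ _ ENNReal.ofReal_ne_top,
        lintegral_comp_smul_pos (fun x => g x ^ (2 : ℝ)) hs', ← mul_assoc,
        ← ENNReal.ofReal_mul (by positivity)]

theorem eLpNorm_le_of_ray {F : Type*} [NormedAddCommGroup F] {f : Euc N → ℝ} {G : Euc N → F}
    (hG : Continuous G) {I : Set ℝ} (hI : MeasurableSet I) (hpos : I ⊆ Ioi 0) {K : ℝ≥0∞}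
    (hA : ∫⁻ s in I, ENNReal.ofReal (s ^ (-(3 / 2) : ℝ)) ≤ K)
    (hB : ∫⁻ s in I, ENNReal.ofReal (s ^ (3 / 2 : ℝ) * (s ^ N)⁻¹) ≤ K)
    (hf : ∀ x, ‖f x‖ₑ ≤ ∫⁻ s in I, ‖G (s • x)‖ₑ) :
    eLpNorm f 2 volume ≤ K * eLpNorm G 2 volume := by
  have h := lintegral_ray_le (g := fun x => ‖G x‖ₑ) hG.enorm.measurable hI hpos
  rw [eLpNorm_eq_lintegral_rpow_enorm_toReal (by norm_num) (by norm_num),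
    eLpNorm_eq_lintegral_rpow_enorm_toReal (by norm_num) (by norm_num)]
  simp only [ENNReal.toReal_ofNat]
  have h3 : ∫⁻ x, ‖f x‖ₑ ^ (2 : ℝ) ≤ K ^ (2 : ℝ) * ∫⁻ x, ‖G x‖ₑ ^ (2 : ℝ) := by
    calc _ ≤ ∫⁻ x, (∫⁻ s in I, ‖G (s • x)‖ₑ) ^ (2 : ℝ) :=
          lintegral_mono fun x => ENNReal.rpow_le_rpow (hf x) (by norm_num)
      _ ≤ _ := h
      _ ≤ K * K * _ := by gcongr
      _ = _ := by norm_num [sq]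
  refine (ENNReal.rpow_le_rpow h3 (by norm_num : (0 : ℝ) ≤ 1 / 2)).trans (le_of_eq ?_)
  rw [ENNReal.mul_rpow_of_nonneg _ _ (by norm_num), ← ENNReal.rpow_mul]
  norm_num

end Ray

/-! ### Test functions: calculus and the Hardy inequality. -/

/-- `φ ∈ C_c^∞(ℝ^N)`. -/
structure IsTest {N : ℕ} (φ : Euc N → ℝ) : Prop where
  contDiff : ContDiff ℝ ∞ φ
  hasCompactSupport : HasCompactSupport φ

namespace IsTest

variable {N : ℕ} {φ ψ : Euc N → ℝ}

theorem differentiable (h : IsTest φ) : Differentiable ℝ φ := h.contDiff.differentiable (by simp)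

theorem continuous (h : IsTest φ) : Continuous φ := h.contDiff.continuous

theorem contDiff_gradient (h : IsTest φ) : ContDiff ℝ ∞ (gradient φ) :=
  (InnerProductSpace.toDual ℝ (Euc N)).symm.toContinuousLinearEquiv.contDiff.comp
    (h.contDiff.fderiv_right (m := ∞) (by simp))

theorem continuous_gradient (h : IsTest φ) : Continuous (gradient φ) := h.contDiff_gradient.continuous

theorem hasCompactSupport_gradient (h : IsTest φ) : HasCompactSupport (gradient φ) :=
  (h.hasCompactSupport.fderiv ℝ).comp_left (map_zero _)

theorem memLp (h : IsTest φ) (p : ℝ≥0∞) : MemLp φ p volume :=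
  h.continuous.memLp_of_hasCompactSupport h.hasCompactSupport

theorem memLp_gradient (h : IsTest φ) (p : ℝ≥0∞) : MemLp (gradient φ) p volume :=
  h.continuous_gradient.memLp_of_hasCompactSupport h.hasCompactSupport_gradient

theorem sub (h : IsTest φ) (h' : IsTest ψ) : IsTest (φ - ψ) :=
  ⟨h.contDiff.sub h'.contDiff, h.hasCompactSupport.sub h'.hasCompactSupport⟩

theorem gradient_sub (h : IsTest φ) (h' : IsTest ψ) :
    gradient (φ - ψ) = gradient φ - gradient ψ := by
  funext x
  simp only [gradient, Pi.sub_apply]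
  rw [fderiv_sub (h.differentiable x) (h'.differentiable x), map_sub]

theorem dil (h : IsTest φ) (a s : ℝ) : IsTest (dil a s φ) :=
  ⟨(h.contDiff.comp (contDiff_const_smul _)).const_smul _, by
    have := (h.hasCompactSupport.comp_smul (Real.exp_pos s).ne')
    exact HasCompactSupport.smul_left (f := fun _ => Real.exp (a * s)) this⟩

theorem gradient_dil (h : IsTest φ) (a s : ℝ) :
    gradient (_root_.dil a s φ) = _root_.dil (a + 1) s (gradient φ) := by
  funext x
  have h1 : HasFDerivAt (fun x : Euc N => Real.exp s • x)
      (Real.exp s • ContinuousLinearMap.id ℝ (Euc N)) x :=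
    ((hasFDerivAt_id x).const_smul (Real.exp s)).congr_of_eventuallyEq (Eventually.of_forall fun _ => rfl)
  have h2 : HasFDerivAt (_root_.dil a s φ) _ x :=
    ((h.differentiable (Real.exp s • x)).hasFDerivAt.comp x h1).const_smul (Real.exp (a * s))
  have h3 : fderiv ℝ (_root_.dil a s φ) x =
      (Real.exp (a * s) * Real.exp s) • fderiv ℝ φ (Real.exp s • x) := by
    rw [h2.fderiv]
    ext v
    simp [mul_assoc]
  simp [gradient, h3, dil_apply, add_mul, Real.exp_add]

theorem norm_fderiv (φ : Euc N → ℝ) (x : Euc N) : ‖fderiv ℝ φ x‖ = ‖gradient φ x‖ := by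
  simp [gradient]

theorem enorm_sub_le (h : IsTest φ) (x : Euc N) {a b : ℝ} (hab : a ≤ b) :
    ‖φ (b • x) - φ (a • x)‖ₑ ≤ ‖x‖ₑ * ∫⁻ s in Ioc a b, ‖gradient φ (s • x)‖ₑ := by
  have hd : ∀ s, HasDerivAt (fun s : ℝ => φ (s • x)) (fderiv ℝ φ (s • x) x) s := by
    intro s
    have h1 : HasDerivAt (fun s : ℝ => s • x) x s := by
      simpa using (hasDerivAt_id s).smul_const x
    exact (h.differentiable (s • x)).hasFDerivAt.comp_hasDerivAt s h1
  have hc : Continuous (fun s : ℝ => fderiv ℝ φ (s • x) x) := by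
    have := h.contDiff.continuous_fderiv (by simp)
    fun_prop
  rw [← intervalIntegral.integral_eq_sub_of_hasDerivAt (fun s _ => hd s)
    (hc.intervalIntegrable _ _), intervalIntegral.integral_of_le hab,
    ← lintegral_const_mul' _ _ (by simp)]
  refine (enorm_integral_le_lintegral_enorm _).trans (lintegral_mono fun s => ?_)
  rw [mul_comm]
  have : ‖gradient φ (s • x)‖ₑ = ‖fderiv ℝ φ (s • x)‖ₑ := by
    rw [← ofReal_norm, ← norm_fderiv, ofReal_norm]
  rw [this]
  exact ContinuousLinearMap.le_opENorm _ _

/-- Since `φ` vanishes far out on the ray through `x`, `|φ(x)| / |x|` is at most the integral of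
`|∇φ(sx)|` over `s > 1`. The constant is `∫_1^∞ s^{-3/2} ds = 2`. -/
theorem hardy (h : IsTest φ) (hN : 3 ≤ N) :
    eLpNorm (fun x => ‖x‖⁻¹ * φ x) 2 volume ≤ 2 * eLpNorm (gradient φ) 2 volume := by
  have hint : ∫⁻ s in Ioi (1 : ℝ), ENNReal.ofReal (s ^ (-(3 / 2) : ℝ)) ≤ 2 := by
    rw [← ofReal_integral_eq_lintegral_ofReal
      (integrableOn_Ioi_rpow_of_lt (by norm_num) one_pos)
      ((ae_restrict_iff' measurableSet_Ioi).2 (Eventually.of_forall fun s hs =>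
        Real.rpow_nonneg (zero_le_one.trans (le_of_lt hs)) _)),
      integral_Ioi_rpow_of_lt (by norm_num) one_pos]
    norm_num
  refine eLpNorm_le_of_ray h.continuous_gradient measurableSet_Ioi (Ioi_subset_Ioi zero_le_one)
    hint ?_ fun x => ?_
  -- For `s > 1` and `N ≥ 3`, `s^{3/2-N} ≤ s^{-3/2}`.
  · refine le_trans (setLIntegral_mono' measurableSet_Ioi fun s hs => ?_) hint
    have hs1 : (1 : ℝ) < s := hs
    have hs0 : 0 < s := one_pos.trans hs1
    refine ENNReal.ofReal_le_ofReal ?_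
    rw [← Real.rpow_natCast, ← Real.rpow_neg hs0.le, ← Real.rpow_add hs0]
    refine Real.rpow_le_rpow_of_exponent_le hs1.le ?_
    have : (3 : ℝ) ≤ N := by exact_mod_cast hN
    linarith
  · by_cases hx : x = 0
    · simp [hx]
    obtain ⟨R, hR⟩ := h.hasCompactSupport.isCompact.isBounded.subset_closedBall (0 : Euc N)
    have hxp : 0 < ‖x‖ := norm_pos_iff.2 hx
    -- At this parameter `T • x` has norm at least `R + 1`, outside the support.
    set T := max 1 ((R + 1) / ‖x‖)
    have hT : φ (T • x) = 0 := by
      by_contra hne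
      have := hR (subset_tsupport _ hne)
      rw [mem_closedBall_zero_iff, norm_smul, Real.norm_of_nonneg
        (zero_le_one.trans (le_max_left _ _))] at this
      have h2 : (R + 1) / ‖x‖ * ‖x‖ ≤ T * ‖x‖ :=
        mul_le_mul_of_nonneg_right (le_max_right _ _) hxp.le
      rw [div_mul_cancel₀ _ hxp.ne'] at h2
      linarith
    have := h.enorm_sub_le x (le_max_left 1 ((R + 1) / ‖x‖))
    rw [hT, one_smul, zero_sub, enorm_neg] at this
    rw [enorm_mul]
    calc ‖‖x‖⁻¹‖ₑ * ‖φ x‖ₑ ≤ ‖‖x‖⁻¹‖ₑ * (‖x‖ₑ * ∫⁻ s in Ioc 1 T, ‖gradient φ (s • x)‖ₑ) := by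
          gcongr
      _ = ∫⁻ s in Ioc 1 T, ‖gradient φ (s • x)‖ₑ := by
          rw [← mul_assoc, ← enorm_norm x, ← enorm_mul, inv_mul_cancel₀ hxp.ne']; simp
      _ ≤ _ := lintegral_mono_set Ioc_subset_Ioi_self

theorem eLpNorm_inv_norm_mul_comp_sub_le (h : IsTest φ) {a b M : ℝ} (ha : 0 < a) (hab : a ≤ b)
    (hA : ∀ s ∈ Ioc a b, s ^ (-(3 / 2) : ℝ) ≤ M)
    (hB : ∀ s ∈ Ioc a b, s ^ (3 / 2 : ℝ) * (s ^ N)⁻¹ ≤ M) :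
    eLpNorm (fun x => ‖x‖⁻¹ * (φ (b • x) - φ (a • x))) 2 volume ≤
      ENNReal.ofReal (M * (b - a)) * eLpNorm (gradient φ) 2 volume := by
  have hb : ∀ w : ℝ → ℝ, (∀ s ∈ Ioc a b, w s ≤ M) →
      ∫⁻ s in Ioc a b, ENNReal.ofReal (w s) ≤ ENNReal.ofReal (M * (b - a)) := by
    intro w hw
    calc _ ≤ ∫⁻ s in Ioc a b, ENNReal.ofReal M :=
          setLIntegral_mono' measurableSet_Ioc fun s hs => ENNReal.ofReal_le_ofReal (hw s hs)
      _ = _ := by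
          rw [setLIntegral_const, Real.volume_Ioc, ENNReal.ofReal_mul' (sub_nonneg.2 hab)]
  refine eLpNorm_le_of_ray h.continuous_gradient measurableSet_Ioc
    (fun s hs => ha.trans hs.1) (hb _ hA) (hb _ hB) fun x => ?_
  by_cases hx : x = 0
  · simp [hx]
  have hxp : 0 < ‖x‖ := norm_pos_iff.2 hx
  have := h.enorm_sub_le x hab
  rw [enorm_mul]
  calc _ ≤ ‖‖x‖⁻¹‖ₑ * (‖x‖ₑ * ∫⁻ s in Ioc a b, ‖gradient φ (s • x)‖ₑ) := by gcongr
    _ = _ := by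
      rw [← mul_assoc, ← enorm_norm x, ← enorm_mul, inv_mul_cancel₀ hxp.ne']; simp

end IsTest

/-! ### The critical exponent; Sobolev and dilation estimates for test functions. -/

/-- The exponent `2^*` in `[0, ∞]`. -/
noncomputable def critExp' (N : ℕ) : ℝ≥0∞ := ENNReal.ofReal (critExp N)

section Exponents

variable {N : ℕ}

theorem sub_two_pos (hN : 3 ≤ N) : (0 : ℝ) < (N : ℝ) - 2 := by
  have : (3 : ℝ) ≤ N := by exact_mod_cast hN
  linarith

theorem two_lt_critExp (hN : 3 ≤ N) : 2 < critExp N := by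
  have := sub_two_pos hN
  rw [critExp, lt_div_iff₀ this]
  linarith

theorem weight_mul_critExp (hN : 3 ≤ N) : ((N : ℝ) - 2) / 2 * critExp N = N := by
  have := sub_two_pos hN
  rw [critExp]
  field_simp

theorem critExp'_ne_zero (hN : 3 ≤ N) : critExp' N ≠ 0 := by
  rw [critExp', ne_eq, ENNReal.ofReal_eq_zero]; linarith [two_lt_critExp hN]

theorem critExp'_ne_top : critExp' N ≠ ⊤ := ENNReal.ofReal_ne_top

theorem inv_critExp (hN : 3 ≤ N) : (critExp N)⁻¹ = 2⁻¹ - (N : ℝ)⁻¹ := by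
  have := sub_two_pos hN
  have : (0 : ℝ) < N := by linarith
  rw [critExp]
  field_simp

theorem one_le_critExp' (hN : 3 ≤ N) : 1 ≤ critExp' N := by
  rw [critExp', ENNReal.one_le_ofReal]; linarith [two_lt_critExp hN]

end Exponents

/-- The constant in the Sobolev inequality. -/
noncomputable def sobolevConst (N : ℕ) : ℝ≥0 :=
  eLpNormLESNormFDerivOfEqInnerConst (volume : Measure (Euc N)) ((2 : ℝ≥0) : ℝ)

/-- The constant in the estimate of `(u_s - u) / |x|`. -/
noncomputable def dilConst (N : ℕ) : ℝ := 4 * N + 2 * Real.exp N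

theorem dilConst_nonneg (N : ℕ) : 0 ≤ dilConst N := by unfold dilConst; positivity

namespace IsTest

variable {N : ℕ} {φ : Euc N → ℝ}

theorem sobolev (h : IsTest φ) (hN : 3 ≤ N) :
    eLpNorm φ (critExp' N) volume ≤ sobolevConst N * eLpNorm (gradient φ) 2 volume := by
  have h1 := eLpNorm_le_eLpNorm_fderiv_of_eq_inner (volume : Measure (Euc N))
    (h.contDiff.of_le (by simp)) h.hasCompactSupport (p := 2) (p' := (critExp N).toNNReal)
    (by norm_num) (by simp; omega) (by
      rw [Real.coe_toNNReal _ (by linarith [two_lt_critExp hN]), inv_critExp hN]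
      simp)
  have h2 : eLpNorm (fderiv ℝ φ) 2 volume = eLpNorm (gradient φ) 2 volume :=
    eLpNorm_congr_norm_ae (Eventually.of_forall fun x => norm_fderiv φ x)
  rw [← h2]
  exact h1

/-- This quantitative form of the Hardy inequality makes the dilation differences `O(s)` in the
weighted norm, although their gradients are only known to be small. The radial variation comes from
the ray bound on the short interval between `1` and `e^s`, the change of prefactor from the Hardy
inequality itself. -/
theorem inv_norm_mul_dil_sub_le (h : IsTest φ) (hN : 3 ≤ N) {s : ℝ} (hs : N * |s| ≤ 1) :
    eLpNorm (fun x => ‖x‖⁻¹ * (_root_.dil (((N : ℝ) - 2) / 2) s φ x - φ x)) 2 volume ≤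
      ENNReal.ofReal (dilConst N * |s|) * eLpNorm (gradient φ) 2 volume := by
  have hN3 : (3 : ℝ) ≤ N := by exact_mod_cast hN
  set c : ℝ := ((N : ℝ) - 2) / 2 with hc
  have hs1 : |s| ≤ 1 := by nlinarith [abs_nonneg s]
  -- For `|log r| ≤ 1` the powers `r^{-3/2}` and `r^{3/2-N}` are at most `e^{3/2}` and `e^{N-3/2}`,
  -- both below `e^N`.
  have hw : ∀ r : ℝ, 0 < r → |Real.log r| ≤ 1 → r ^ (-(3 / 2) : ℝ) ≤ Real.exp N ∧
      r ^ (3 / 2 : ℝ) * (r ^ N)⁻¹ ≤ Real.exp N := by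
    intro r hr hl
    obtain ⟨h1, h2⟩ := abs_le.1 hl
    rw [← Real.rpow_natCast, ← Real.rpow_neg hr.le, ← Real.rpow_add hr, Real.rpow_def_of_pos hr,
      Real.rpow_def_of_pos hr]
    constructor <;> refine Real.exp_le_exp.2 ?_ <;> nlinarith
  have hexp : |Real.exp s - 1| ≤ 2 * |s| := Real.abs_exp_sub_one_le hs1
  have key : eLpNorm (fun x => ‖x‖⁻¹ * (φ (Real.exp s • x) - φ x)) 2 volume ≤
      ENNReal.ofReal (Real.exp N * (2 * |s|)) * eLpNorm (gradient φ) 2 volume := by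
    rcases le_total 0 s with h0 | h0
    · have h1 : (1 : ℝ) ≤ Real.exp s := Real.one_le_exp h0
      have hl : ∀ r ∈ Ioc 1 (Real.exp s), |Real.log r| ≤ 1 := by
        intro r hr
        rw [abs_of_nonneg (Real.log_nonneg hr.1.le)]
        have := Real.log_le_log (one_pos.trans hr.1) hr.2
        rw [Real.log_exp] at this
        exact this.trans ((le_abs_self s).trans hs1)
      have := h.eLpNorm_inv_norm_mul_comp_sub_le one_pos h1 (M := Real.exp N)
        (fun r hr => (hw r (one_pos.trans hr.1) (hl r hr)).1)
        (fun r hr => (hw r (one_pos.trans hr.1) (hl r hr)).2)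
      simp only [one_smul] at this
      refine this.trans ?_
      gcongr
      exact (le_abs_self _).trans hexp
    · have h1 : Real.exp s ≤ 1 := Real.exp_le_one_iff.2 h0
      have hl : ∀ r ∈ Ioc (Real.exp s) 1, |Real.log r| ≤ 1 := by
        intro r hr
        have hr0 := (Real.exp_pos s).trans hr.1
        rw [abs_of_nonpos (Real.log_nonpos hr0.le hr.2)]
        have := Real.log_le_log (Real.exp_pos s) hr.1.le
        rw [Real.log_exp] at this
        linarith [neg_abs_le s]
      have := h.eLpNorm_inv_norm_mul_comp_sub_le (Real.exp_pos s) h1 (M := Real.exp N)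
        (fun r hr => (hw r ((Real.exp_pos s).trans hr.1) (hl r hr)).1)
        (fun r hr => (hw r ((Real.exp_pos s).trans hr.1) (hl r hr)).2)
      simp only [one_smul] at this
      rw [← eLpNorm_neg]
      refine le_trans (le_of_eq ?_) (this.trans ?_)
      · congr 1
        funext x
        simp only [Pi.neg_apply]; ring
      · gcongr
        rw [← neg_sub]
        exact (neg_le_abs _).trans hexp
  have hmeas : ∀ f : Euc N → ℝ, Continuous f →
      AEStronglyMeasurable (fun x : Euc N => ‖x‖⁻¹ * f x) volume := fun f hf => by
    have : Measurable f := hf.measurable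
    exact Measurable.aestronglyMeasurable (by fun_prop)
  -- Writing the first term through the dilate `φ_s` rather than `φ(e^s x)` keeps its weighted norm
  -- equal to that of `φ`.
  have hsplit : (fun x => ‖x‖⁻¹ * (_root_.dil c s φ x - φ x)) =
      (fun x => (1 - Real.exp (-(c * s))) * (‖x‖⁻¹ * _root_.dil c s φ x)) +
        fun x => ‖x‖⁻¹ * (φ (Real.exp s • x) - φ x) := by
    funext x
    simp only [dil_apply, smul_eq_mul, Pi.add_apply, Real.exp_neg]
    have := (Real.exp_pos (c * s)).ne'
    field_simp
    ring
  have h1 : eLpNorm (fun x => (1 - Real.exp (-(c * s))) * (‖x‖⁻¹ * _root_.dil c s φ x)) 2 volume ≤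
      ENNReal.ofReal (4 * N * |s|) * eLpNorm (gradient φ) 2 volume := by
    have e1 : (fun x => (1 - Real.exp (-(c * s))) * (‖x‖⁻¹ * _root_.dil c s φ x)) =
        (1 - Real.exp (-(c * s))) • _root_.dil (c + 1) s (fun x => ‖x‖⁻¹ * φ x) := by
      rw [← inv_norm_mul_dil]; rfl
    rw [e1, eLpNorm_const_smul, eLpNorm_dil _ (by norm_num) (by norm_num)
      (by rw [hc]; norm_num; ring)]
    have hcs : |-(c * s)| ≤ N * |s| := by
      rw [abs_neg, abs_mul, abs_of_nonneg (by rw [hc]; linarith)]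
      gcongr
      rw [hc]; linarith
    have h2 : ‖1 - Real.exp (-(c * s))‖ₑ ≤ ENNReal.ofReal (2 * (N * |s|)) := by
      rw [← ofReal_norm, Real.norm_eq_abs, abs_sub_comm]
      refine ENNReal.ofReal_le_ofReal ((Real.abs_exp_sub_one_le (hcs.trans hs)).trans ?_)
      gcongr
    calc _ ≤ ENNReal.ofReal (2 * (N * |s|)) * (2 * eLpNorm (gradient φ) 2 volume) := by
          gcongr
          exact h.hardy hN
      _ = _ := by
          rw [← mul_assoc]
          congr 1
          rw [← ENNReal.ofReal_ofNat, ← ENNReal.ofReal_mul (by positivity)]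
          congr 1; ring
  rw [hsplit]
  refine (eLpNorm_add_le ?_ ?_ (by norm_num)).trans ((add_le_add h1 key).trans (le_of_eq ?_))
  · exact (hmeas _ (h.dil c s).continuous).const_mul _
  · exact hmeas _ ((h.continuous.comp (continuous_const_smul _)).sub h.continuous)
  · rw [← add_mul, ← ENNReal.ofReal_add (by positivity) (by positivity)]
    congr 2
    unfold dilConst; ring

end IsTest

/-! ### Limits of test functions: transfer of the inequalities. -/

/-- `(u, Du)` is a limit of test functions, almost everywhere for `u`, and in `L^2` for the
gradient. -/
structure TestLimit {N : ℕ} (u : Euc N → ℝ) (Du : Euc N → Euc N) : Prop where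
  memLp_grad : MemLp Du 2 volume
  exists_seq : ∃ φ : ℕ → Euc N → ℝ, (∀ n, IsTest (φ n)) ∧
    (∀ᵐ x, Tendsto (fun n => φ n x) atTop (𝓝 (u x))) ∧
    Tendsto (fun n => eLpNorm (gradient (φ n) - Du) 2 volume) atTop (𝓝 0)

theorem IsTest.testLimit {N : ℕ} {φ : Euc N → ℝ} (h : IsTest φ) : TestLimit φ (gradient φ) :=
  ⟨h.memLp_gradient 2, fun _ => φ, fun _ => h, by simp, by simp⟩

namespace TestLimit

variable {N : ℕ} {u v : Euc N → ℝ} {Du Dv : Euc N → Euc N}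

theorem sub (h : TestLimit u Du) (h' : TestLimit v Dv) : TestLimit (u - v) (Du - Dv) := by
  obtain ⟨φ, h1, h2, h3⟩ := h.exists_seq
  obtain ⟨ψ, k1, k2, k3⟩ := h'.exists_seq
  refine ⟨h.memLp_grad.sub h'.memLp_grad, fun n => φ n - ψ n, fun n => (h1 n).sub (k1 n), ?_, ?_⟩
  · filter_upwards [h2, k2] with x hx kx using hx.sub kx
  · refine tendsto_of_tendsto_of_tendsto_of_le_of_le tendsto_const_nhds
      (by simpa using h3.add k3) (fun _ => zero_le) fun n => ?_
    have : gradient (φ n - ψ n) - (Du - Dv) = (gradient (φ n) - Du) - (gradient (ψ n) - Dv) := by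
      rw [(h1 n).gradient_sub (k1 n)]; abel
    dsimp only
    rw [this]
    exact eLpNorm_sub_le (((h1 n).memLp_gradient 2).sub h.memLp_grad).1
      (((k1 n).memLp_gradient 2).sub h'.memLp_grad).1 (by norm_num)

theorem dil (h : TestLimit u Du) (s : ℝ) :
    TestLimit (dil (((N : ℝ) - 2) / 2) s u) (dil ((N : ℝ) / 2) s Du) := by
  obtain ⟨φ, h1, h2, h3⟩ := h.exists_seq
  have hw : (N : ℝ) / 2 * (2 : ℝ≥0∞).toReal = N := by simp
  refine ⟨memLp_dil (by norm_num) (by norm_num) hw h.memLp_grad,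
    fun n => _root_.dil (((N : ℝ) - 2) / 2) s (φ n), fun n => (h1 n).dil _ _, ?_, ?_⟩
  · filter_upwards [ae_exp_smul h2 s] with x hx using hx.const_smul _
  · refine h3.congr fun n => ?_
    rw [(h1 n).gradient_dil, show ((N : ℝ) - 2) / 2 + 1 = N / 2 by ring, ← dil_sub,
      eLpNorm_dil _ (by norm_num) (by norm_num) hw]

theorem aestronglyMeasurable (h : TestLimit u Du) : AEStronglyMeasurable u volume := by
  obtain ⟨φ, h1, h2, -⟩ := h.exists_seq
  exact aestronglyMeasurable_of_tendsto_ae atTop (fun n => (h1 n).continuous.aestronglyMeasurable) h2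

/-- Fatou's lemma along the approximating sequence, whose gradient norms are asymptotically at most
that of `Du`. It carries the Sobolev, Hardy and dilation estimates from test functions to their
limits. -/
theorem eLpNorm_le_of_isTest (h : TestLimit u Du) {p K : ℝ≥0∞} (hK : K ≠ ⊤)
    {T : (Euc N → ℝ) → Euc N → ℝ}
    (hT : ∀ φ, IsTest φ → AEStronglyMeasurable (T φ) volume ∧
      eLpNorm (T φ) p volume ≤ K * eLpNorm (gradient φ) 2 volume)
    (hlim : ∀ φ : ℕ → Euc N → ℝ, (∀ᵐ x, Tendsto (fun n => φ n x) atTop (𝓝 (u x))) →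
      ∀ᵐ x, Tendsto (fun n => T (φ n) x) atTop (𝓝 (T u x))) :
    eLpNorm (T u) p volume ≤ K * eLpNorm Du 2 volume := by
  obtain ⟨φ, h1, h2, h3⟩ := h.exists_seq
  refine (Lp.eLpNorm_lim_le_liminf_eLpNorm (fun n => (hT _ (h1 n)).1) _ (hlim φ h2)).trans ?_
  have hb : Tendsto (fun n => K * (eLpNorm (gradient (φ n) - Du) 2 volume + eLpNorm Du 2 volume))
      atTop (𝓝 (K * eLpNorm Du 2 volume)) := by
    simpa using ENNReal.Tendsto.const_mul (h3.add_const (eLpNorm Du 2 volume)) (Or.inr hK)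
  rw [← hb.liminf_eq]
  refine liminf_le_liminf (Eventually.of_forall fun n => (hT _ (h1 n)).2.trans ?_)
  gcongr
  calc eLpNorm (gradient (φ n)) 2 volume = eLpNorm ((gradient (φ n) - Du) + Du) 2 volume := by simp
    _ ≤ _ := eLpNorm_add_le (((h1 n).memLp_gradient 2).sub h.memLp_grad).1 h.memLp_grad.1
      (by norm_num)

theorem sobolev (h : TestLimit u Du) (hN : 3 ≤ N) :
    eLpNorm u (critExp' N) volume ≤ sobolevConst N * eLpNorm Du 2 volume :=
  h.eLpNorm_le_of_isTest (T := id) ENNReal.coe_ne_top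
    (fun _ hφ => ⟨hφ.continuous.aestronglyMeasurable, hφ.sobolev hN⟩) fun _ hφ => hφ

theorem memLp (h : TestLimit u Du) (hN : 3 ≤ N) : MemLp u (critExp' N) volume :=
  ⟨h.aestronglyMeasurable, (h.sobolev hN).trans_lt
    (ENNReal.mul_lt_top ENNReal.coe_lt_top h.memLp_grad.2)⟩

theorem aestronglyMeasurable_inv_norm_mul {f : Euc N → ℝ} (hf : AEStronglyMeasurable f volume) :
    AEStronglyMeasurable (fun x : Euc N => ‖x‖⁻¹ * f x) volume :=
  (Measurable.aestronglyMeasurable (by fun_prop)).mul hf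

theorem hardy (h : TestLimit u Du) (hN : 3 ≤ N) :
    eLpNorm (fun x => ‖x‖⁻¹ * u x) 2 volume ≤ 2 * eLpNorm Du 2 volume :=
  h.eLpNorm_le_of_isTest (T := fun u x => ‖x‖⁻¹ * u x) (by norm_num)
    (fun _ hφ => ⟨aestronglyMeasurable_inv_norm_mul hφ.continuous.aestronglyMeasurable,
      hφ.hardy hN⟩) fun φ hφ => by
        filter_upwards [hφ] with x hx using hx.const_mul _

theorem memLp_inv_norm_mul (h : TestLimit u Du) (hN : 3 ≤ N) :
    MemLp (fun x => ‖x‖⁻¹ * u x) 2 volume :=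
  ⟨aestronglyMeasurable_inv_norm_mul h.aestronglyMeasurable, (h.hardy hN).trans_lt
    (ENNReal.mul_lt_top (by norm_num) h.memLp_grad.2)⟩

theorem inv_norm_mul_dil_sub_le (h : TestLimit u Du) (hN : 3 ≤ N) {s : ℝ} (hs : N * |s| ≤ 1) :
    eLpNorm (fun x => ‖x‖⁻¹ * (_root_.dil (((N : ℝ) - 2) / 2) s u x - u x)) 2 volume ≤
      ENNReal.ofReal (dilConst N * |s|) * eLpNorm Du 2 volume :=
  h.eLpNorm_le_of_isTest (T := fun u x => ‖x‖⁻¹ * (_root_.dil (((N : ℝ) - 2) / 2) s u x - u x))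
    ENNReal.ofReal_ne_top
    (fun _ hφ => ⟨aestronglyMeasurable_inv_norm_mul
      (((hφ.dil _ _).continuous.sub hφ.continuous).aestronglyMeasurable),
      hφ.inv_norm_mul_dil_sub_le hN hs⟩) fun φ hφ => by
        filter_upwards [hφ, ae_exp_smul hφ s] with x hx hx'
        exact ((hx'.const_smul _).sub hx).const_mul _

/-- The approximating test functions converge in all the norms controlled by the gradient. -/
theorem exists_seq_tendsto (h : TestLimit u Du) (hN : 3 ≤ N) :
    ∃ φ : ℕ → Euc N → ℝ, (∀ n, IsTest (φ n)) ∧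
      Tendsto (fun n => eLpNorm (φ n - u) (critExp' N) volume) atTop (𝓝 0) ∧
      Tendsto (fun n => eLpNorm (fun x => ‖x‖⁻¹ * (φ n - u) x) 2 volume) atTop (𝓝 0) ∧
      Tendsto (fun n => eLpNorm (gradient (φ n) - Du) 2 volume) atTop (𝓝 0) := by
  obtain ⟨φ, h1, -, h3⟩ := h.exists_seq
  refine ⟨φ, h1, ?_, ?_, h3⟩
  · refine tendsto_of_tendsto_of_tendsto_of_le_of_le tendsto_const_nhds ?_ (fun _ => zero_le)
      fun n => ((h1 n).testLimit.sub h).sobolev hN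
    simpa using ENNReal.Tendsto.const_mul h3 (Or.inr ENNReal.coe_ne_top)
  · refine tendsto_of_tendsto_of_tendsto_of_le_of_le tendsto_const_nhds ?_ (fun _ => zero_le)
      fun n => ((h1 n).testLimit.sub h).hardy hN
    simpa using ENNReal.Tendsto.const_mul h3 (Or.inr (by norm_num))

end TestLimit

/-! ### Mollification in `L^p`. -/

section Mollify

variable {N : ℕ} {F : Type*} [NormedAddCommGroup F] [NormedSpace ℝ F]

/-- Convolution with a normalised bump function. -/
noncomputable def mollify (ρ : ContDiffBump (0 : Euc N)) (f : Euc N → F) : Euc N → F :=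
  ρ.normed volume ⋆[ContinuousLinearMap.lsmul ℝ ℝ, volume] f

theorem mollify_apply (ρ : ContDiffBump (0 : Euc N)) (f : Euc N → F) (x : Euc N) :
    mollify ρ f x = ∫ t, ρ.normed volume t • f (x - t) := rfl

theorem mollify_apply_swap (ρ : ContDiffBump (0 : Euc N)) (f : Euc N → F) (x : Euc N) :
    mollify ρ f x = ∫ t, ρ.normed volume (x - t) • f t := convolution_lsmul_swap

theorem convolutionExists_mollify (ρ : ContDiffBump (0 : Euc N)) {f : Euc N → F}
    (hf : LocallyIntegrable f volume) :
    ConvolutionExists (ρ.normed volume) f (ContinuousLinearMap.lsmul ℝ ℝ) volume :=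
  ρ.hasCompactSupport_normed.convolutionExists_left _ ρ.continuous_normed hf

theorem contDiff_mollify [CompleteSpace F] (ρ : ContDiffBump (0 : Euc N)) {f : Euc N → F}
    (hf : LocallyIntegrable f volume) : ContDiff ℝ ∞ (mollify ρ f) :=
  ρ.hasCompactSupport_normed.contDiff_convolution_left (n := ⊤) _ ρ.contDiff_normed hf

theorem mollify_sub (ρ : ContDiffBump (0 : Euc N)) {f g : Euc N → F}
    (hf : LocallyIntegrable f volume) (hg : LocallyIntegrable g volume) :
    mollify ρ (f - g) = mollify ρ f - mollify ρ g := by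
  funext x
  simp only [mollify_apply, Pi.sub_apply, smul_sub]
  exact integral_sub (convolutionExists_mollify ρ hf x) (convolutionExists_mollify ρ hg x)

theorem lintegral_ofReal_normed (ρ : ContDiffBump (0 : Euc N)) :
    ∫⁻ x, ENNReal.ofReal (ρ.normed volume x) = 1 := by
  rw [← ofReal_integral_eq_lintegral_ofReal ρ.integrable_normed
    (Eventually.of_forall ρ.nonneg_normed), ρ.integral_normed, ENNReal.ofReal_one]

/-- The kernel is the density of a probability measure, so the `L^1` mean is at most the `L^p` mean
pointwise; Tonelli and translation invariance finish. -/
theorem eLpNorm_mollify_le (ρ : ContDiffBump (0 : Euc N)) {f : Euc N → F}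
    (hf : AEStronglyMeasurable f volume) {p : ℝ≥0∞} (h1 : 1 ≤ p) (hp : p ≠ ⊤) :
    eLpNorm (mollify ρ f) p volume ≤ eLpNorm f p volume := by
  have hp0 : p ≠ 0 := (zero_lt_one.trans_le h1).ne'
  have hpos : 0 < p.toReal := ENNReal.toReal_pos hp0 hp
  set w : Euc N → ℝ≥0∞ := fun x => ENNReal.ofReal (ρ.normed volume x)
  have hw : Measurable w := ρ.continuous_normed.measurable.ennreal_ofReal
  set ν : Measure (Euc N) := volume.withDensity w
  have hν : IsProbabilityMeasure ν := ⟨by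
    rw [withDensity_apply _ MeasurableSet.univ, setLIntegral_univ]; exact lintegral_ofReal_normed ρ⟩
  have hac : ν ≪ volume := withDensity_absolutelyContinuous _ _
  have hfx : ∀ x, AEStronglyMeasurable (fun t => f (x - t)) volume := fun x =>
    hf.comp_quasiMeasurePreserving (quasiMeasurePreserving_sub_left_of_right_invariant volume x)
  have hpt : ∀ x, ‖mollify ρ f x‖ₑ ^ p.toReal ≤ ∫⁻ t, ‖f (x - t)‖ₑ ^ p.toReal ∂ν := by
    intro x
    have a1 : ‖mollify ρ f x‖ₑ ≤ eLpNorm (fun t => f (x - t)) 1 ν := by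
      rw [mollify_apply, eLpNorm_one_eq_lintegral_enorm,
        lintegral_withDensity_eq_lintegral_mul₀ hw.aemeasurable (hfx x).enorm]
      refine (enorm_integral_le_lintegral_enorm _).trans (lintegral_mono fun t => ?_)
      simp only [Pi.mul_apply, w]
      rw [enorm_smul, Real.enorm_of_nonneg (ρ.nonneg_normed t)]
    have a2 := eLpNorm_le_eLpNorm_of_exponent_le h1 ((hfx x).mono_ac hac)
    refine (ENNReal.rpow_le_rpow (a1.trans a2) hpos.le).trans (le_of_eq ?_)
    rw [eLpNorm_eq_lintegral_rpow_enorm_toReal hp0 hp, ← ENNReal.rpow_mul,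
      one_div_mul_cancel hpos.ne', ENNReal.rpow_one]
  rw [eLpNorm_eq_lintegral_rpow_enorm_toReal hp0 hp, eLpNorm_eq_lintegral_rpow_enorm_toReal hp0 hp]
  refine ENNReal.rpow_le_rpow ?_ (by positivity)
  have hj : AEMeasurable (Function.uncurry fun x t : Euc N => ‖f (x - t)‖ₑ ^ p.toReal)
      (volume.prod ν) :=
    ((hf.comp_quasiMeasurePreserving
      (quasiMeasurePreserving_sub_of_right_invariant volume ν)).enorm).pow_const _
  calc _ ≤ ∫⁻ x, ∫⁻ t, ‖f (x - t)‖ₑ ^ p.toReal ∂ν := lintegral_mono hpt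
    _ = ∫⁻ t, (∫⁻ x, ‖f (x - t)‖ₑ ^ p.toReal) ∂ν := lintegral_lintegral_swap hj
    _ = ∫⁻ _, (∫⁻ x, ‖f x‖ₑ ^ p.toReal) ∂ν := by
      congr 1
      funext t
      exact lintegral_sub_right_eq_self (fun x => ‖f x‖ₑ ^ p.toReal) t
    _ = _ := by simp

theorem memLp_mollify [CompleteSpace F] (ρ : ContDiffBump (0 : Euc N)) {f : Euc N → F} {p : ℝ≥0∞}
    (hf : MemLp f p volume) (h1 : 1 ≤ p) (hp : p ≠ ⊤) : MemLp (mollify ρ f) p volume :=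
  ⟨(contDiff_mollify ρ (hf.locallyIntegrable h1)).continuous.aestronglyMeasurable,
    (eLpNorm_mollify_le ρ hf.1 h1 hp).trans_lt hf.2⟩

theorem tendsto_eLpNorm_mollify_sub_of_continuous [CompleteSpace F] {g : Euc N → F} (hg : Continuous g)
    (hgs : HasCompactSupport g) {ρ : ℕ → ContDiffBump (0 : Euc N)}
    (hρ : Tendsto (fun n => (ρ n).rOut) atTop (𝓝 0)) (p : ℝ≥0∞) :
    Tendsto (fun n => eLpNorm (mollify (ρ n) g - g) p volume) atTop (𝓝 0) := by
  set K := Metric.cthickening 1 (tsupport g) with hK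
  have hKc : IsCompact K := hgs.isCompact.cthickening
  have huc := hgs.uniformContinuous_of_continuous hg
  have key : ∀ ε : ℝ, 0 < ε → ∀ᶠ n in atTop, eLpNorm (mollify (ρ n) g - g) p volume ≤
      ENNReal.ofReal ε * volume K ^ (1 / p.toReal) := by
    intro ε hε
    obtain ⟨δ, hδ, hδ'⟩ := Metric.uniformContinuous_iff.1 huc ε hε
    filter_upwards [hρ.eventually (gt_mem_nhds hδ), hρ.eventually (gt_mem_nhds one_pos)] with n hn hn1
    have hb : ∀ x, ‖(mollify (ρ n) g - g) x‖ ≤ ε := by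
      intro x
      rw [Pi.sub_apply, ← dist_eq_norm]
      exact ContDiffBump.dist_normed_convolution_le hg.aestronglyMeasurable fun y hy =>
        (hδ' (lt_trans hy hn)).le
    have hsupp : Function.support (mollify (ρ n) g - g) ⊆ K := by
      intro x hx
      by_contra hxK
      have hfar : ∀ y ∈ Metric.ball x (ρ n).rOut, g y = 0 := by
        intro y hy
        by_contra hne
        refine hxK (Metric.mem_cthickening_of_dist_le x y 1 _ (subset_tsupport _ hne) ?_)
        rw [dist_comm]
        exact (lt_trans hy hn1).le
      have hx0 : g x = 0 := hfar x (Metric.mem_ball_self (ρ n).rOut_pos)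
      refine hx ?_
      rw [Pi.sub_apply, hx0, sub_zero]
      have := ContDiffBump.normed_convolution_eq_right (φ := ρ n) (μ := volume) (g := g) (x₀ := x)
        fun y hy => by rw [hfar y hy, hx0]
      rw [mollify, this, hx0]
    rw [← eLpNorm_restrict_eq_of_support_subset hsupp]
    refine (eLpNorm_le_of_ae_bound (Eventually.of_forall hb)).trans (le_of_eq ?_)
    rw [Measure.restrict_apply_univ, mul_comm, one_div]
  have hC : volume K ^ (1 / p.toReal) ≠ ⊤ :=
    ENNReal.rpow_ne_top_of_nonneg (by positivity) hKc.measure_lt_top.ne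
  rw [ENNReal.tendsto_nhds_zero]
  intro ε hε
  have ht : Tendsto (fun r : ℝ => ENNReal.ofReal r * volume K ^ (1 / p.toReal)) (𝓝[>] 0) (𝓝 0) := by
    have : Tendsto (fun r : ℝ => ENNReal.ofReal r) (𝓝[>] 0) (𝓝 0) := by
      have := (ENNReal.continuous_ofReal.tendsto 0).mono_left (nhdsWithin_le_nhds (s := Ioi 0))
      simpa using this
    simpa using ENNReal.Tendsto.mul_const this (Or.inr hC)
  obtain ⟨r, hr, hr0⟩ := ((ht.eventually (gt_mem_nhds hε)).and self_mem_nhdsWithin).exists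
  filter_upwards [key r hr0] with n hn using hn.trans hr.le

/-- Compactly supported continuous functions are dense in `L^p`, and mollification is a contraction,
so the continuous case suffices. -/
theorem tendsto_eLpNorm_mollify_sub [CompleteSpace F] {f : Euc N → F} {p : ℝ≥0∞}
    (hf : MemLp f p volume) {ρ : ℕ → ContDiffBump (0 : Euc N)}
    (hρ : Tendsto (fun n => (ρ n).rOut) atTop (𝓝 0)) (h1 : 1 ≤ p) (hp : p ≠ ⊤) :
    Tendsto (fun n => eLpNorm (mollify (ρ n) f - f) p volume) atTop (𝓝 0) := by
  rw [ENNReal.tendsto_nhds_zero]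
  intro ε hε
  have hε3 : ε / 3 ≠ 0 := (ENNReal.div_pos hε.ne' (by norm_num)).ne'
  obtain ⟨g, hgs, hfg, hgc, hg⟩ := hf.exists_hasCompactSupport_eLpNorm_sub_le hp hε3
  have hfl := hf.locallyIntegrable h1
  have hgl := hg.locallyIntegrable h1
  have := tendsto_eLpNorm_mollify_sub_of_continuous hgc hgs hρ p
  filter_upwards [this.eventually (gt_mem_nhds (pos_iff_ne_zero.2 hε3))] with n hn
  have hsplit : mollify (ρ n) f - f = mollify (ρ n) (f - g) + ((mollify (ρ n) g - g) - (f - g)) := by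
    rw [mollify_sub _ hfl hgl]; abel
  have m1 := memLp_mollify (ρ n) (hf.sub hg) h1 hp
  have m2 := (memLp_mollify (ρ n) hg h1 hp).sub hg
  rw [hsplit]
  calc _ ≤ eLpNorm (mollify (ρ n) (f - g)) p volume + (eLpNorm (mollify (ρ n) g - g) p volume +
        eLpNorm (f - g) p volume) :=
        (eLpNorm_add_le m1.1 (m2.sub (hf.sub hg)).1 h1).trans
          (add_le_add le_rfl (eLpNorm_sub_le m2.1 (hf.sub hg).1 h1))
    _ ≤ ε / 3 + (ε / 3 + ε / 3) := by
        gcongr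
        exact (eLpNorm_mollify_le _ (hf.sub hg).1 h1 hp).trans hfg
    _ = ε := by rw [← add_assoc, ENNReal.add_thirds]

end Mollify

/-- The derivative falls on the kernel, and `t ↦ ρ(x - t)` is a test function, admissible in the
definition of the weak gradient. -/
theorem fderiv_mollify_apply {N : ℕ} {u : Euc N → ℝ} {Du : Euc N → Euc N} (h : HasWeakGradient u Du)
    (ρ : ContDiffBump (0 : Euc N)) (x w : Euc N) :
    fderiv ℝ (mollify ρ u) x w = inner ℝ (mollify ρ Du x) w := by
  have hρ1 : ContDiff ℝ 1 (ρ.normed (volume : Measure (Euc N))) := ρ.contDiff_normed (n := 1)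
  have hflip : mollify ρ u =
      u ⋆[(ContinuousLinearMap.lsmul ℝ ℝ).flip, volume] ρ.normed volume := by
    rw [convolution_flip]; rfl
  have hd := ρ.hasCompactSupport_normed.hasFDerivAt_convolution_right
    (ContinuousLinearMap.lsmul ℝ ℝ).flip h.locallyIntegrable hρ1 x
  rw [← hflip] at hd
  rw [hd.fderiv, convolution_precompR_apply _ h.locallyIntegrable
    (ρ.hasCompactSupport_normed.fderiv ℝ) (hρ1.continuous_fderiv one_ne_zero)]
  have hφd : ∀ t, fderiv ℝ (fun t => ρ.normed volume (x - t)) t w =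
      - fderiv ℝ (ρ.normed volume) (x - t) w := by
    intro t
    have h1 : HasFDerivAt (fun t : Euc N => x - t) (-ContinuousLinearMap.id ℝ (Euc N)) t :=
      (hasFDerivAt_id t).const_sub x
    have h2 := (hρ1.differentiable one_ne_zero (x - t)).hasFDerivAt.comp t h1
    have h3 : fderiv ℝ (fun t => ρ.normed volume (x - t)) t = _ := h2.fderiv
    rw [h3]; simp
  have hw := h.integral_eq (fun t => ρ.normed volume (x - t))
    ((ρ.contDiff_normed (n := ⊤)).comp (contDiff_const.sub contDiff_id))
    (ρ.hasCompactSupport_normed.comp_homeomorph (Homeomorph.subLeft x)) w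
  simp only [hφd, mul_neg, integral_neg, neg_inj] at hw
  rw [convolution_def]
  simp only [ContinuousLinearMap.flip_apply, ContinuousLinearMap.lsmul_apply, smul_eq_mul]
  have hint := ConvolutionExistsAt.integrable_swap (convolutionExists_mollify ρ h.locallyIntegrable_grad x)
  simp only [ContinuousLinearMap.lsmul_apply] at hint
  rw [mollify_apply_swap, real_inner_comm, ← integral_inner hint]
  simp only [inner_smul_right]
  rw [← integral_congr_ae (Eventually.of_forall fun t => mul_comm _ _), hw]
  refine integral_congr_ae (Eventually.of_forall fun t => ?_)
  simp only [real_inner_comm w]; ring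

theorem gradient_mollify {N : ℕ} {u : Euc N → ℝ} {Du : Euc N → Euc N} (h : HasWeakGradient u Du)
    (ρ : ContDiffBump (0 : Euc N)) : gradient (mollify ρ u) = mollify ρ Du := by
  funext x
  refine ext_inner_right ℝ fun w => ?_
  rw [inner_gradient_left, fderiv_mollify_apply h]

/-! ### Density of test functions in `D^{1,2}`. -/

theorem tendsto_eLpNorm_zero_of_dominated {N : ℕ} {F : Type*} [NormedAddCommGroup F]
    {g : ℝ → Euc N → F} {f : Euc N → F} {p : ℝ≥0∞} (hp0 : p ≠ 0) (hp : p ≠ ⊤) (hf : MemLp f p volume)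
    (hg : ∀ᶠ r in atTop, AEStronglyMeasurable (g r) volume)
    (hle : ∀ᶠ r in atTop, ∀ x, ‖g r x‖ₑ ≤ ‖f x‖ₑ)
    (hlim : ∀ᵐ x, ∀ᶠ r in atTop, g r x = 0) :
    Tendsto (fun r : ℝ => eLpNorm (g r) p volume) atTop (𝓝 0) := by
  have hpos : 0 < p.toReal := ENNReal.toReal_pos hp0 hp
  simp_rw [eLpNorm_eq_lintegral_rpow_enorm_toReal hp0 hp]
  have key : Tendsto (fun r : ℝ => ∫⁻ x, ‖g r x‖ₑ ^ p.toReal) atTop (𝓝 (∫⁻ _ : Euc N, 0)) := by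
    refine tendsto_lintegral_filter_of_dominated_convergence' (fun x => ‖f x‖ₑ ^ p.toReal)
      (hg.mono fun r h => h.enorm.pow_const _)
      (hle.mono fun r h => Eventually.of_forall fun x => ?_)
      (lintegral_rpow_enorm_lt_top_of_eLpNorm_lt_top hp0 hp hf.2).ne ?_
    · gcongr
      exact h x
    · filter_upwards [hlim] with x hx
      refine tendsto_const_nhds.congr' ?_
      filter_upwards [hx] with r hr
      simp [hr, hpos]
  have h2 := key.ennrpow_const (1 / p.toReal)
  simpa [hpos] using h2

theorem tendsto_eLpNorm_indicator_le_norm {N : ℕ} {F : Type*} [NormedAddCommGroup F]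
    {f : Euc N → F} {p : ℝ≥0∞} (hp0 : p ≠ 0) (hp : p ≠ ⊤) (hf : MemLp f p volume) :
    Tendsto (fun r : ℝ => eLpNorm ({x | r ≤ ‖x‖}.indicator f) p volume) atTop (𝓝 0) := by
  have hm : ∀ r : ℝ, MeasurableSet {x : Euc N | r ≤ ‖x‖} := fun r =>
    measurableSet_le measurable_const measurable_norm
  refine tendsto_eLpNorm_zero_of_dominated hp0 hp hf
    (Eventually.of_forall fun r => hf.1.indicator (hm r))
    (Eventually.of_forall fun r x => enorm_indicator_le_enorm_self _ _)
    (Eventually.of_forall fun x => ?_)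
  filter_upwards [eventually_gt_atTop ‖x‖] with r hr
  exact indicator_of_notMem (by simpa using hr) _

/-- Cutoff at a large scale. In `∇(χv) - ∇v = (χ - 1)∇v + v∇χ` both terms live far out; the second
is estimated by Hölder with `‖∇χ‖_N`, which does not depend on the scale. Equality with `v` on a
large ball preserves almost everywhere convergence. -/
theorem exists_isTest_gradient_sub_le {N : ℕ} (hN : 3 ≤ N) {v : Euc N → ℝ} (hv : ContDiff ℝ ∞ v)
    (hvq : MemLp v (critExp' N) volume) (hDv : MemLp (gradient v) 2 volume) {ε : ℝ≥0∞} (hε : ε ≠ 0)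
    (R : ℝ) : ∃ φ, IsTest φ ∧ (∀ x, ‖x‖ ≤ R → φ x = v x) ∧
      eLpNorm (gradient φ - gradient v) 2 volume ≤ ε := by
  let η : ContDiffBump (0 : Euc N) := ⟨1, 2, one_pos, one_lt_two⟩
  have hη : IsTest η := ⟨η.contDiff, η.hasCompactSupport⟩
  have hNpos : (0 : ℝ) < N := by have := sub_two_pos hN; linarith
  have hN0 : (N : ℝ≥0∞) ≠ 0 := by simp; omega
  have hNt : (N : ℝ≥0∞) ≠ ⊤ := by simp
  -- This is `1/2^* + 1/N = 1/2`.
  have hH : ENNReal.HolderTriple (critExp' N) N 2 := ⟨by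
    rw [critExp', ← ENNReal.ofReal_natCast, ← ENNReal.ofReal_ofNat,
      ← ENNReal.ofReal_inv_of_pos (by linarith [two_lt_critExp hN]),
      ← ENNReal.ofReal_inv_of_pos hNpos, ← ENNReal.ofReal_inv_of_pos two_pos,
      ← ENNReal.ofReal_add (by have := two_lt_critExp hN; positivity) (by positivity),
      inv_critExp hN]
    congr 1; ring⟩
  have t1 := tendsto_eLpNorm_indicator_le_norm (by norm_num) (by norm_num) hDv
  have t2 := tendsto_eLpNorm_indicator_le_norm (critExp'_ne_zero hN) critExp'_ne_top hvq
  have hC : eLpNorm (gradient η) N volume ≠ ⊤ := (hη.memLp_gradient _).2.ne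
  have t3 := t1.add (ENNReal.Tendsto.mul_const t2 (Or.inr hC))
  rw [zero_mul, add_zero] at t3
  obtain ⟨r, hr, hrR⟩ := (((t3.comp Real.tendsto_exp_atTop).eventually
    (gt_mem_nhds (pos_iff_ne_zero.2 hε))).and
    (Real.tendsto_exp_atTop.eventually_ge_atTop R)).exists
  simp only [Function.comp_apply] at hr
  set χ : Euc N → ℝ := dil 0 (-r) η with hχ
  have hχt : IsTest χ := hη.dil _ _
  have hχ1 : ∀ x, ‖x‖ ≤ Real.exp r → χ x = 1 := by
    intro x hx
    simp only [hχ, dil_apply, zero_mul, Real.exp_zero, one_smul]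
    refine η.one_of_mem_closedBall ?_
    rw [mem_closedBall_zero_iff, norm_smul, Real.norm_of_nonneg (Real.exp_pos _).le, Real.exp_neg]
    exact inv_mul_le_one_of_le₀ hx (Real.exp_pos _).le
  have hχ01 : ∀ x, |1 - χ x| ≤ 1 := by
    intro x
    have h0 : 0 ≤ χ x := by simp only [hχ, dil_apply, zero_mul, Real.exp_zero, one_smul]; exact η.nonneg
    have h1 : χ x ≤ 1 := by simp only [hχ, dil_apply, zero_mul, Real.exp_zero, one_smul]; exact η.le_one
    rw [abs_le]; constructor <;> linarith
  have hgχ : ∀ x, ‖x‖ < Real.exp r → gradient χ x = 0 := by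
    intro x hx
    have : χ =ᶠ[𝓝 x] fun _ => 1 := by
      filter_upwards [(isOpen_lt continuous_norm continuous_const).mem_nhds hx] with y hy
      exact hχ1 y (le_of_lt hy)
    rw [this.gradient_eq]
    simp [gradient]
  have hvd : Differentiable ℝ v := hv.differentiable (by simp)
  have hgrad : gradient (fun x => χ x * v x) = fun x => χ x • gradient v x + v x • gradient χ x := by
    funext x
    have h1 : HasFDerivAt (fun x => χ x * v x) (χ x • fderiv ℝ v x + v x • fderiv ℝ χ x) x :=
      (hχt.differentiable x).hasFDerivAt.mul (hvd x).hasFDerivAt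
    simp [gradient, h1.fderiv]
  refine ⟨fun x => χ x * v x, ⟨hχt.contDiff.mul hv, hχt.hasCompactSupport.mul_right⟩,
    fun x hx => by simp [hχ1 x (hx.trans hrR)], ?_⟩
  set S : Set (Euc N) := {x | Real.exp r ≤ ‖x‖} with hS
  have hSm : MeasurableSet S := measurableSet_le measurable_const measurable_norm
  have hsplit : gradient (fun x => χ x * v x) - gradient v =
      (fun x => (χ x - 1) • S.indicator (gradient v) x) + S.indicator v • gradient χ := by
    funext x
    simp only [hgrad, Pi.sub_apply, Pi.add_apply, Pi.smul_apply']
    by_cases hx : x ∈ S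
    · rw [indicator_of_mem hx, indicator_of_mem hx]; module
    · have hx' : ‖x‖ < Real.exp r := not_le.1 hx
      rw [indicator_of_notMem hx, indicator_of_notMem hx, hχ1 x hx'.le, hgχ x hx']
      simp
  have hgχN : eLpNorm (gradient χ) N volume = eLpNorm (gradient η) N volume := by
    rw [hχ, hη.gradient_dil, eLpNorm_dil _ hN0 hNt (by simp)]
  rw [hsplit]
  refine le_trans ((eLpNorm_add_le ?_ ?_ (by norm_num)).trans (add_le_add ?_ ?_)) hr.le
  · exact (hχt.continuous.sub continuous_const).aestronglyMeasurable.smul (hDv.1.indicator hSm)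
  · exact (hvq.1.indicator hSm).smul (hχt.memLp_gradient 2).1
  · refine eLpNorm_mono fun x => ?_
    rw [norm_smul, Real.norm_eq_abs, abs_sub_comm]
    exact mul_le_of_le_one_left (norm_nonneg _) (hχ01 x)
  · rw [← hgχN]
    exact eLpNorm_smul_le_mul_eLpNorm (hχt.memLp_gradient 2).1 (hvq.1.indicator hSm)

/-- Mollify at scale `1/(n+1)`, then cut off outside the ball of radius `n` with gradient error
`1/n`. -/
theorem MemD12.testLimit {N : ℕ} (hN : 3 ≤ N) {u : Euc N → ℝ} {Du : Euc N → Euc N}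
    (h : MemD12 u Du) : TestLimit u Du := by
  -- The fixed ratio `2` of the radii is required for almost everywhere convergence of the
  -- convolutions by Lebesgue differentiation.
  let ρ : ℕ → ContDiffBump (0 : Euc N) := fun n =>
    ⟨1 / ((n : ℝ) + 1), 2 * (1 / ((n : ℝ) + 1)), by positivity,
      lt_mul_of_one_lt_left (by positivity) one_lt_two⟩
  have hρ : Tendsto (fun n => (ρ n).rOut) atTop (𝓝 0) := by
    simpa [ρ] using (tendsto_one_div_add_atTop_nhds_zero_nat (𝕜 := ℝ)).const_mul 2
  have hw := h.hasWeakGradient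
  have hv : ∀ n, ContDiff ℝ ∞ (mollify (ρ n) u) := fun n => contDiff_mollify _ hw.locallyIntegrable
  have hg : ∀ n, gradient (mollify (ρ n) u) = mollify (ρ n) Du := fun n => gradient_mollify hw _
  have hDv : ∀ n, MemLp (gradient (mollify (ρ n) u)) 2 volume := fun n => by
    rw [hg]; exact memLp_mollify _ h.memLp_grad (by norm_num) (by norm_num)
  have hvq : ∀ n, MemLp (mollify (ρ n) u) (critExp' N) volume := fun n =>
    memLp_mollify _ h.memLp (one_le_critExp' hN) critExp'_ne_top
  choose φ h1 h2 h3 using fun n : ℕ => exists_isTest_gradient_sub_le hN (hv n) (hvq n) (hDv n)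
    (ε := (n : ℝ≥0∞)⁻¹) (by simp) n
  refine ⟨h.memLp_grad, φ, h1, ?_, ?_⟩
  · have hae := ContDiffBump.ae_convolution_tendsto_right_of_locallyIntegrable (μ := volume)
      (φ := ρ) (K := 2) hρ (Eventually.of_forall fun n => le_rfl) hw.locallyIntegrable
    filter_upwards [hae] with x hx
    refine hx.congr' ?_
    filter_upwards [tendsto_natCast_atTop_atTop.eventually_ge_atTop ‖x‖] with n hn
    exact (h2 n x hn).symm
  · have t := ENNReal.tendsto_inv_nat_nhds_zero.add
      (tendsto_eLpNorm_mollify_sub h.memLp_grad hρ (by norm_num) (by norm_num))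
    rw [add_zero] at t
    refine tendsto_of_tendsto_of_tendsto_of_le_of_le tendsto_const_nhds t (fun _ => zero_le)
      fun n => ?_
    have e : gradient (φ n) - Du = (gradient (φ n) - gradient (mollify (ρ n) u)) +
        (mollify (ρ n) Du - Du) := by rw [hg]; abel
    dsimp only
    rw [e]
    refine (eLpNorm_add_le (((h1 n).memLp_gradient 2).sub (hDv n)).1
      ((hg n ▸ hDv n).sub h.memLp_grad).1 (by norm_num)).trans ?_
    gcongr
    exact h3 n

/-! ### Hölder pairings, in particular of `|x| H` with `g / |x|`. -/

theorem abs_integral_mul_le {N : ℕ} {f g : Euc N → ℝ} {p q : ℝ≥0∞} [ENNReal.HolderConjugate p q]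
    (hf : MemLp f p volume) (hg : MemLp g q volume) :
    |∫ x, f x * g x| ≤ (eLpNorm f p volume).toReal * (eLpNorm g q volume).toReal := by
  have h := eLpNorm_smul_le_mul_eLpNorm (p := p) (q := q) (r := 1) hg.1 hf.1
  rw [← ENNReal.toReal_mul, ← Real.norm_eq_abs]
  refine (norm_integral_le_lintegral_norm _).trans
    (ENNReal.toReal_mono (ENNReal.mul_ne_top hf.2.ne hg.2.ne) (le_trans (le_of_eq ?_) h))
  rw [eLpNorm_one_eq_lintegral_enorm]
  simp only [ofReal_norm, Pi.smul_apply', smul_eq_mul]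

theorem integrable_mul_of_memLp {N : ℕ} {f g : Euc N → ℝ} {p q : ℝ≥0∞} [ENNReal.HolderConjugate p q]
    (hf : MemLp f p volume) (hg : MemLp g q volume) : Integrable (fun x => f x * g x) volume :=
  hf.integrable_mul hg

section Weighted

variable {N : ℕ} {H g : Euc N → ℝ}

theorem ae_mul_eq_weighted (hN : 3 ≤ N) (H g : Euc N → ℝ) :
    ∀ᵐ x, (‖x‖ * H x) * (‖x‖⁻¹ * g x) = H x * g x := by
  have : Nontrivial (Euc N) := by
    have : Nonempty (Fin N) := ⟨⟨0, by omega⟩⟩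
    infer_instance
  filter_upwards [compl_mem_ae_iff.2 (measure_singleton (0 : Euc N))] with x hx
  have : ‖x‖ ≠ 0 := norm_ne_zero_iff.2 hx
  field_simp

theorem integrable_mul_of_weighted (hN : 3 ≤ N) (hH : MemLp (fun x => ‖x‖ * H x) 2 volume)
    (hg : MemLp (fun x => ‖x‖⁻¹ * g x) 2 volume) : Integrable (fun x => H x * g x) volume :=
  (integrable_mul_of_memLp hH hg).congr (ae_mul_eq_weighted hN H g)

theorem abs_integral_mul_le_weighted (hN : 3 ≤ N) (hH : MemLp (fun x => ‖x‖ * H x) 2 volume)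
    (hg : MemLp (fun x => ‖x‖⁻¹ * g x) 2 volume) :
    |∫ x, H x * g x| ≤ (eLpNorm (fun x => ‖x‖ * H x) 2 volume).toReal *
      (eLpNorm (fun x => ‖x‖⁻¹ * g x) 2 volume).toReal := by
  rw [← integral_congr_ae (ae_mul_eq_weighted hN H g)]
  exact abs_integral_mul_le hH hg

end Weighted

/-! ### Differentiating `∫ H u_s` at `s = 0`. -/

/-- The generator `x · ∇u + (N - 2) / 2 u` of the dilations. -/
noncomputable def dilGen {N : ℕ} (u : Euc N → ℝ) (Du : Euc N → Euc N) : Euc N → ℝ :=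
  fun x => inner ℝ x (Du x) + ((N : ℝ) - 2) / 2 * u x

theorem IsTest.hasDerivAt_dil {N : ℕ} {ψ : Euc N → ℝ} (h : IsTest ψ) (x : Euc N) (s : ℝ) :
    HasDerivAt (fun s => _root_.dil (((N : ℝ) - 2) / 2) s ψ x)
      (_root_.dil (((N : ℝ) - 2) / 2) s (dilGen ψ (gradient ψ)) x) s := by
  set c : ℝ := ((N : ℝ) - 2) / 2 with hc
  have h1 : HasDerivAt (fun s : ℝ => Real.exp s • x) (Real.exp s • x) s :=
    (Real.hasDerivAt_exp s).smul_const x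
  have h2 := (h.differentiable (Real.exp s • x)).hasFDerivAt.comp_hasDerivAt s h1
  have h3 : HasDerivAt (fun s : ℝ => Real.exp (c * s)) (Real.exp (c * s) * c) s := by
    simpa using ((hasDerivAt_id s).const_mul c).exp
  have h4 := h3.mul h2
  refine h4.congr_deriv ?_
  simp only [dil_apply, dilGen, inner_gradient_right, smul_eq_mul, Function.comp_apply, conj_trivial]
  rw [← hc]; ring

theorem IsTest.tendsto_integral_dil_sub {N : ℕ} {ψ : Euc N → ℝ} (h : IsTest ψ) (hN : 3 ≤ N)
    {H : Euc N → ℝ} (hH : LocallyIntegrable H volume) :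
    Tendsto (fun s : ℝ => s⁻¹ * ∫ x, H x * (_root_.dil (((N : ℝ) - 2) / 2) s ψ x - ψ x)) (𝓝[≠] 0)
      (𝓝 (∫ x, H x * dilGen ψ (gradient ψ) x)) := by
  set c : ℝ := ((N : ℝ) - 2) / 2 with hc
  have hc0 : 0 ≤ c := by rw [hc]; linarith [sub_two_pos hN]
  have hZc : Continuous (dilGen ψ (gradient ψ)) := by
    have := h.continuous; have := h.continuous_gradient
    unfold dilGen; fun_prop
  have hZs : HasCompactSupport (dilGen ψ (gradient ψ)) := by
    have h1 : HasCompactSupport (fun x => inner ℝ x (gradient ψ x)) :=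
      h.hasCompactSupport_gradient.mono fun x hx hx0 => hx (by simp [hx0])
    exact h1.add (h.hasCompactSupport.mul_left (f := fun _ => c))
  obtain ⟨M, hM⟩ := hZc.bounded_above_of_compact_support hZs
  obtain ⟨R, hR⟩ := hZs.isCompact.isBounded.subset_closedBall (0 : Euc N)
  have hM0 : 0 ≤ M := (norm_nonneg _).trans (hM 0)
  -- For `|s| ≤ 1` every dilate of the generator is supported in this ball. With the mean value
  -- inequality this dominates the difference quotients.
  set K : Set (Euc N) := Metric.closedBall 0 (Real.exp 1 * R)
  have hbound : ∀ x, ∀ s ∈ Icc (-1 : ℝ) 1, ‖_root_.dil c s (dilGen ψ (gradient ψ)) x‖ ≤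
      K.indicator (fun _ => Real.exp c * M) x := by
    intro x s hs
    by_cases hx : x ∈ K
    · rw [indicator_of_mem hx, dil_apply, norm_smul, Real.norm_of_nonneg (Real.exp_pos _).le]
      gcongr
      · nlinarith [hs.2]
      · exact hM _
    · rw [indicator_of_notMem hx, dil_apply]
      have : dilGen ψ (gradient ψ) (Real.exp s • x) = 0 := by
        by_contra hne
        have h1 := hR (subset_tsupport _ hne)
        rw [mem_closedBall_zero_iff, norm_smul, Real.norm_of_nonneg (Real.exp_pos _).le] at h1
        refine hx (mem_closedBall_zero_iff.2 ?_)
        calc ‖x‖ = Real.exp (-s) * (Real.exp s * ‖x‖) := by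
              rw [← mul_assoc, ← Real.exp_add]; simp
          _ ≤ Real.exp 1 * R := by
              gcongr
              linarith [hs.1]
      simp [this]
  have hmv : ∀ x, ∀ s ∈ Icc (-1 : ℝ) 1, ‖_root_.dil c s ψ x - ψ x‖ ≤
      K.indicator (fun _ => Real.exp c * M) x * |s| := by
    intro x s hs
    have := (convex_Icc (-1 : ℝ) 1).norm_image_sub_le_of_norm_hasDerivWithin_le
      (f := fun s => _root_.dil c s ψ x)
      (fun t ht => (h.hasDerivAt_dil x t).hasDerivWithinAt) (fun t ht => hbound x t ht)
      (x := 0) (y := s) (by norm_num) hs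
    simpa [dil_zero] using this
  simp_rw [← integral_const_mul]
  refine tendsto_integral_filter_of_dominated_convergence
    (fun x => ‖H x‖ * K.indicator (fun _ => Real.exp c * M) x) ?_ ?_ ?_ ?_
  · refine Eventually.of_forall fun s => ?_
    exact (hH.aestronglyMeasurable.mul
      ((h.dil c s).continuous.sub h.continuous).aestronglyMeasurable).const_mul _
  · have h1 : ∀ᶠ s : ℝ in 𝓝[≠] 0, s ∈ Icc (-1 : ℝ) 1 :=
      mem_nhdsWithin_of_mem_nhds (Icc_mem_nhds (by norm_num) (by norm_num))
    filter_upwards [h1, self_mem_nhdsWithin] with s hs hs0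
    refine Eventually.of_forall fun x => ?_
    have hs0' : |s| ≠ 0 := abs_ne_zero.2 hs0
    rw [norm_mul, norm_mul, norm_inv, Real.norm_eq_abs s]
    calc _ ≤ |s|⁻¹ * (‖H x‖ * (K.indicator (fun _ => Real.exp c * M) x * |s|)) := by
          gcongr
          exact hmv x s hs
      _ = _ := by field_simp
  · have h1 : IntegrableOn H K volume := hH.integrableOn_isCompact (isCompact_closedBall _ _)
    have h2 := (show IntegrableOn (fun x => ‖H x‖ * (Real.exp c * M)) K volume from
      h1.norm.mul_const (Real.exp c * M)).integrable_indicator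
      Metric.isClosed_closedBall.measurableSet
    refine h2.congr (Eventually.of_forall fun x => ?_)
    by_cases hx : x ∈ K <;> simp [hx]
  · refine Eventually.of_forall fun x => ?_
    have h1 := (h.hasDerivAt_dil x 0).tendsto_slope_zero
    rw [dil_zero] at h1
    have h2 := h1.const_mul (H x)
    rw [dil_zero] at h2
    refine h2.congr fun s => ?_
    simp only [zero_add, smul_eq_mul]
    ring

namespace TestLimit

variable {N : ℕ} {u : Euc N → ℝ} {Du : Euc N → Euc N} {H : Euc N → ℝ}

/-- The constant is `1 + 2c` with `c = (N-2)/2`: `1` from `|x · Du| ≤ |x| |Du|` and `2c` from the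
Hardy inequality. Paired with `|x| H ∈ L^2`, this is the integrability claim of the theorem. -/
theorem memLp_inv_norm_mul_dilGen (h : TestLimit u Du) (hN : 3 ≤ N) :
    MemLp (fun x => ‖x‖⁻¹ * dilGen u Du x) 2 volume ∧
      eLpNorm (fun x => ‖x‖⁻¹ * dilGen u Du x) 2 volume ≤
        ENNReal.ofReal ((N : ℝ) - 1) * eLpNorm Du 2 volume := by
  set c : ℝ := ((N : ℝ) - 2) / 2 with hc
  have hc0 : 0 ≤ c := by rw [hc]; linarith [sub_two_pos hN]
  have hm1 : AEStronglyMeasurable (fun x : Euc N => ‖x‖⁻¹ * inner ℝ x (Du x)) volume :=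
    aestronglyMeasurable_inv_norm_mul (aestronglyMeasurable_id.inner h.memLp_grad.1)
  have hle1 : eLpNorm (fun x : Euc N => ‖x‖⁻¹ * inner ℝ x (Du x)) 2 volume ≤
      eLpNorm Du 2 volume := by
    refine eLpNorm_mono fun x => ?_
    rw [norm_mul, norm_inv, norm_norm]
    calc _ ≤ ‖x‖⁻¹ * (‖x‖ * ‖Du x‖) := by gcongr; exact norm_inner_le_norm _ _
      _ ≤ ‖Du x‖ := by
        rw [← mul_assoc]
        exact mul_le_of_le_one_left (norm_nonneg _) inv_mul_le_one
  have hle2 : eLpNorm (c • fun x : Euc N => ‖x‖⁻¹ * u x) 2 volume ≤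
      ENNReal.ofReal (2 * c) * eLpNorm Du 2 volume := by
    rw [eLpNorm_const_smul, Real.enorm_of_nonneg hc0]
    calc _ ≤ ENNReal.ofReal c * (2 * eLpNorm Du 2 volume) := by gcongr; exact h.hardy hN
      _ = _ := by
        rw [ENNReal.ofReal_mul (by norm_num), ENNReal.ofReal_ofNat]; ring
  have hsplit : (fun x => ‖x‖⁻¹ * dilGen u Du x) =
      (fun x : Euc N => ‖x‖⁻¹ * inner ℝ x (Du x)) + c • fun x : Euc N => ‖x‖⁻¹ * u x := by
    funext x
    simp only [dilGen, Pi.add_apply, Pi.smul_apply, smul_eq_mul]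
    rw [← hc]; ring
  have hm2 := (h.memLp_inv_norm_mul hN).const_smul c
  rw [hsplit]
  have hle : eLpNorm ((fun x : Euc N => ‖x‖⁻¹ * inner ℝ x (Du x)) + c • fun x : Euc N => ‖x‖⁻¹ * u x)
      2 volume ≤ ENNReal.ofReal ((N : ℝ) - 1) * eLpNorm Du 2 volume := by
    refine (eLpNorm_add_le hm1 hm2.1 (by norm_num)).trans ((add_le_add hle1 hle2).trans (le_of_eq ?_))
    rw [show (N : ℝ) - 1 = 1 + 2 * c by rw [hc]; ring, ENNReal.ofReal_add one_pos.le (by positivity)]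
    simp [add_mul]
  exact ⟨⟨hm1.add hm2.1, hle.trans_lt (ENNReal.mul_lt_top ENNReal.ofReal_lt_top h.memLp_grad.2)⟩, hle⟩

theorem memLp_inv_norm_mul_dil_sub (h : TestLimit u Du) (hN : 3 ≤ N) (s : ℝ) :
    MemLp (fun x => ‖x‖⁻¹ * (_root_.dil (((N : ℝ) - 2) / 2) s u x - u x)) 2 volume :=
  ((h.dil s).sub h).memLp_inv_norm_mul hN

/-- The difference quotients, for `N |s| ≤ 1`, and the limit functional are linear and bounded by
the `L^2` norm of the gradient uniformly in `s`, so the convergence extends from test functions to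
their limits. -/
theorem tendsto_integral_dil_sub (h : TestLimit u Du) (hN : 3 ≤ N)
    (hH : LocallyIntegrable H volume) (hHw : MemLp (fun x => ‖x‖ * H x) 2 volume) :
    Tendsto (fun s : ℝ => s⁻¹ * ∫ x, H x * (_root_.dil (((N : ℝ) - 2) / 2) s u x - u x)) (𝓝[≠] 0)
      (𝓝 (∫ x, H x * dilGen u Du x)) := by
  obtain ⟨φ, h1, -, -, h3⟩ := h.exists_seq_tendsto hN
  set c : ℝ := ((N : ℝ) - 2) / 2 with hc
  have hNpos : (0 : ℝ) < (N : ℝ) - 1 := by linarith [sub_two_pos hN]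
  set A := (eLpNorm (fun x => ‖x‖ * H x) 2 volume).toReal
  have hA : 0 ≤ A := ENNReal.toReal_nonneg
  have hlim : Tendsto (fun n => A * (dilConst N + (N - 1)) *
      (eLpNorm (gradient (φ n) - Du) 2 volume).toReal) atTop (𝓝 0) := by
    have := ((ENNReal.tendsto_toReal ENNReal.zero_ne_top).comp h3).const_mul
      (A * (dilConst N + (N - 1)))
    simpa using this
  rw [Metric.tendsto_nhds]
  intro ε hε
  obtain ⟨n, hn⟩ := (hlim.eventually (gt_mem_nhds (half_pos hε))).exists
  have hg := (h1 n).testLimit.sub h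
  set d := (eLpNorm (gradient (φ n) - Du) 2 volume).toReal with hd
  have hdt : eLpNorm (gradient (φ n) - Du) 2 volume ≠ ⊤ := hg.memLp_grad.2.ne
  have hL : |∫ x, H x * dilGen (φ n - u) (gradient (φ n) - Du) x| ≤ A * ((N - 1) * d) := by
    obtain ⟨m1, m2⟩ := hg.memLp_inv_norm_mul_dilGen hN
    refine (abs_integral_mul_le_weighted hN hHw m1).trans ?_
    gcongr
    have := ENNReal.toReal_mono (ENNReal.mul_ne_top ENNReal.ofReal_ne_top hdt) m2
    rwa [ENNReal.toReal_mul, ENNReal.toReal_ofReal hNpos.le] at this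
  have hLsub : ∫ x, H x * dilGen (φ n - u) (gradient (φ n) - Du) x =
      (∫ x, H x * dilGen (φ n) (gradient (φ n)) x) - ∫ x, H x * dilGen u Du x := by
    rw [← integral_sub
      (integrable_mul_of_weighted hN hHw ((h1 n).testLimit.memLp_inv_norm_mul_dilGen hN).1)
      (integrable_mul_of_weighted hN hHw (h.memLp_inv_norm_mul_dilGen hN).1)]
    congr 1
    funext x
    simp only [dilGen, Pi.sub_apply, inner_sub_right]; ring
  have hD : ∀ s : ℝ, s ≠ 0 → N * |s| ≤ 1 →
      |s⁻¹ * ∫ x, H x * (_root_.dil c s (φ n - u) x - (φ n - u) x)| ≤ A * (dilConst N * d) := by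
    intro s hs0 hs
    have m1 := hg.memLp_inv_norm_mul_dil_sub hN s
    have m2 := hg.inv_norm_mul_dil_sub_le hN hs
    have h2 := abs_integral_mul_le_weighted hN hHw m1
    have h3 := ENNReal.toReal_mono (ENNReal.mul_ne_top ENNReal.ofReal_ne_top hdt) m2
    rw [ENNReal.toReal_mul, ENNReal.toReal_ofReal
      (mul_nonneg (dilConst_nonneg N) (abs_nonneg s))] at h3
    have hs0' : |s| ≠ 0 := abs_ne_zero.2 hs0
    rw [abs_mul, abs_inv]
    calc _ ≤ |s|⁻¹ * (A * (dilConst N * |s| * d)) := by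
          gcongr
          exact h2.trans (mul_le_mul_of_nonneg_left h3 hA)
      _ = _ := by field_simp
  have hDsub : ∀ s : ℝ, ∫ x, H x * (_root_.dil c s (φ n - u) x - (φ n - u) x) =
      (∫ x, H x * (_root_.dil c s (φ n) x - φ n x)) - ∫ x, H x * (_root_.dil c s u x - u x) := by
    intro s
    rw [← integral_sub
      (integrable_mul_of_weighted hN hHw ((h1 n).testLimit.memLp_inv_norm_mul_dil_sub hN s))
      (integrable_mul_of_weighted hN hHw (h.memLp_inv_norm_mul_dil_sub hN s))]
    congr 1
    funext x
    simp only [dil_sub, Pi.sub_apply]; ring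
  have hsmall : ∀ᶠ s : ℝ in 𝓝[≠] 0, N * |s| ≤ 1 := by
    have : Tendsto (fun s : ℝ => N * |s|) (𝓝[≠] 0) (𝓝 0) := by
      have : Continuous (fun s : ℝ => N * |s|) := by fun_prop
      simpa using (this.tendsto 0).mono_left (nhdsWithin_le_nhds (s := {0}ᶜ))
    exact (this.eventually (gt_mem_nhds one_pos)).mono fun s hs => hs.le
  have hφ := Metric.tendsto_nhds.1 ((h1 n).tendsto_integral_dil_sub hN hH) _ (half_pos hε)
  filter_upwards [hφ, hsmall, self_mem_nhdsWithin] with s h5 h6 h7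
  have h8 := hD s h7 h6
  rw [hDsub, mul_sub] at h8
  rw [hLsub] at hL
  rw [Real.dist_eq] at h5 ⊢
  rw [abs_lt] at h5 ⊢
  rw [abs_le] at h8 hL
  have : A * (dilConst N + (N - 1)) * d = A * (dilConst N * d) + A * ((N - 1) * d) := by ring
  constructor <;> linarith [h5.1, h5.2, h8.1, h8.2, hL.1, hL.2]

end TestLimit

/-! ### Convexity inequalities for powers. -/

section Rpow

/-- Bernoulli's inequality at `b / a`. -/
theorem rpow_tangent_le {a b q : ℝ} (ha : 0 < a) (hb : 0 < b) (hq : 1 ≤ q) :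
    q * a ^ (q - 1) * (b - a) ≤ b ^ q - a ^ q := by
  have h := one_add_mul_self_le_rpow_one_add (s := b / a - 1)
    (by have := div_pos hb ha; linarith) hq
  rw [add_sub_cancel, Real.div_rpow hb.le ha.le] at h
  have haq : 0 < a ^ q := Real.rpow_pos_of_pos ha q
  rw [le_div_iff₀ haq] at h
  have h1 : a ^ (q - 1) = a ^ q / a := by rw [Real.rpow_sub ha, Real.rpow_one]
  rw [h1]
  have : (1 + q * (b / a - 1)) * a ^ q = a ^ q + q * (a ^ q / a) * (b - a) := by
    field_simp
  linarith

theorem abs_rpow_sub_le {a b p : ℝ} (ha : 0 < a) (hb : 0 < b) (hp : 1 ≤ p) :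
    |b ^ p - a ^ p| ≤ p * (a ^ (p - 1) + b ^ (p - 1)) * |b - a| := by
  have h1 := rpow_tangent_le ha hb hp
  have h2 := rpow_tangent_le hb ha hp
  have ha' : 0 ≤ p * a ^ (p - 1) := by positivity
  have hb' : 0 ≤ p * b ^ (p - 1) := by positivity
  rcases le_total a b with h | h
  · rw [abs_of_nonneg (sub_nonneg.2 h), abs_of_nonneg (sub_nonneg.2 (by gcongr))]
    nlinarith
  · rw [abs_of_nonpos (sub_nonpos.2 h), abs_of_nonpos (sub_nonpos.2 (by gcongr))]
    nlinarith

/-- The tangent line at `a` makes the remainder nonnegative; the tangent line at `b` bounds it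
above. -/
theorem abs_rpow_sub_sub_le {a b q : ℝ} (ha : 0 < a) (hb : 0 < b) (hq : 1 ≤ q) :
    |b ^ q - a ^ q - q * (a ^ (q - 1) * (b - a))| ≤
      q * (|b ^ (q - 1) - a ^ (q - 1)| * |b - a|) := by
  have h1 := rpow_tangent_le ha hb hq
  have h2 := rpow_tangent_le hb ha hq
  rw [← abs_mul]
  refine (abs_of_nonneg (by linarith)).le.trans ?_
  have := mul_le_mul_of_nonneg_left (le_abs_self ((b ^ (q - 1) - a ^ (q - 1)) * (b - a)))
    (zero_le_one.trans hq)
  refine le_trans ?_ this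
  linarith

end Rpow

/-! ### Form bounds for potentials in `L^{N/2}`, where `N/2 = 2^*/(2^* - 2)`. -/

section Potential

variable {N : ℕ}

theorem holderConjugate_critExp' (hN : 3 ≤ N) :
    ENNReal.HolderConjugate (critExp' N / ENNReal.ofReal (critExp N - 1)) (critExp' N) := by
  have h := two_lt_critExp hN
  refine ⟨?_⟩
  rw [critExp', ← ENNReal.ofReal_div_of_pos (by linarith), ← ENNReal.ofReal_inv_of_pos (by
    apply div_pos <;> linarith), ← ENNReal.ofReal_inv_of_pos (by linarith),
    ← ENNReal.ofReal_add (by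
      have : 0 < critExp N - 1 := by linarith
      positivity) (by positivity), inv_one, ← ENNReal.ofReal_one]
  congr 1
  have : critExp N ≠ 0 := by linarith
  have : critExp N - 1 ≠ 0 := by linarith
  field_simp
  ring

theorem holderConjugate_critExp'_half (hN : 3 ≤ N) :
    ENNReal.HolderConjugate (critExp' N / ENNReal.ofReal (critExp N - 2)) (critExp' N / 2) := by
  have h := two_lt_critExp hN
  refine ⟨?_⟩
  rw [critExp', ← ENNReal.ofReal_div_of_pos (by linarith), ← ENNReal.ofReal_ofNat,
    ← ENNReal.ofReal_div_of_pos (by norm_num), ← ENNReal.ofReal_inv_of_pos (by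
    apply div_pos <;> linarith), ← ENNReal.ofReal_inv_of_pos (by linarith),
    ← ENNReal.ofReal_add (by
      have : 0 < critExp N - 2 := by linarith
      positivity) (by positivity), inv_one, ← ENNReal.ofReal_one]
  congr 1
  have : critExp N ≠ 0 := by linarith
  have : critExp N - 2 ≠ 0 := by linarith
  field_simp
  ring

theorem holderTriple_critExp'_half : ENNReal.HolderTriple (critExp' N) (critExp' N) (critExp' N / 2) := by
  refine ⟨?_⟩
  rw [ENNReal.inv_div (by norm_num) (by norm_num), ← two_mul, div_eq_mul_inv]

theorem memLp_norm_rpow_sub {u : Euc N → ℝ} (hu : MemLp u (critExp' N) volume)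
    (a : ℝ) (ha : 0 < a) :
    MemLp (fun x => |u x| ^ a) (critExp' N / ENNReal.ofReal a) volume := by
  have := hu.norm_rpow_div (ENNReal.ofReal a)
  rwa [ENNReal.toReal_ofReal ha.le] at this

theorem integral_sq_le {f : Euc N → ℝ} (hf : MemLp f 2 volume) :
    Integrable (fun x => f x ^ 2) volume ∧ ∫ x, f x ^ 2 ≤ (eLpNorm f 2 volume).toReal ^ 2 := by
  refine ⟨hf.integrable_sq, ?_⟩
  have := (le_abs_self _).trans (abs_integral_mul_le hf hf)
  simpa [sq] using this

theorem integral_mul_sq_le (hN : 3 ≤ N) {g w : Euc N → ℝ}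
    (hg : MemLp g (critExp' N / ENNReal.ofReal (critExp N - 2)) volume)
    (hw : MemLp w (critExp' N) volume) :
    Integrable (fun x => g x * w x ^ 2) volume ∧
      ∫ x, g x * w x ^ 2 ≤ (eLpNorm g (critExp' N / ENNReal.ofReal (critExp N - 2)) volume).toReal *
        (eLpNorm w (critExp' N) volume).toReal ^ 2 := by
  have := holderConjugate_critExp'_half hN
  have := holderTriple_critExp'_half (N := N)
  have hww : MemLp (w • w) (critExp' N / 2) volume := hw.smul hw
  have hle := eLpNorm_smul_le_mul_eLpNorm (r := critExp' N / 2) hw.1 hw.1 (p := critExp' N)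
    (q := critExp' N)
  have hle' := ENNReal.toReal_mono (ENNReal.mul_ne_top hw.2.ne hw.2.ne) hle
  rw [ENNReal.toReal_mul, ← sq] at hle'
  have e : (fun x => g x * w x ^ 2) = fun x => g x * (w • w) x := by
    funext x; simp [sq]
  rw [e]
  refine ⟨integrable_mul_of_memLp hg hww, (le_abs_self _).trans ((abs_integral_mul_le hg hww).trans ?_)⟩
  gcongr

/-- A potential in the scale invariant Lebesgue space is form bounded, with arbitrarily small
bound, up to a multiple of the Hardy potential. -/
theorem exists_integral_potential_le (hN : 3 ≤ N) {V : Euc N → ℝ} (hV0 : ∀ x, 0 ≤ V x)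
    (hV : MemLp V (critExp' N / ENNReal.ofReal (critExp N - 2)) volume) {ε : ℝ} (hε : 0 < ε) :
    ∃ K : ℝ, 0 ≤ K ∧ ∀ w : Euc N → ℝ, MemLp w (critExp' N) volume →
      MemLp (fun x => ‖x‖⁻¹ * w x) 2 volume →
      ∫ x, V x * w x ^ 2 ≤ ε * (eLpNorm w (critExp' N) volume).toReal ^ 2 +
        K * (eLpNorm (fun x => ‖x‖⁻¹ * w x) 2 volume).toReal ^ 2 := by
  have hq := two_lt_critExp hN
  set P := critExp' N / ENNReal.ofReal (critExp N - 2) with hP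
  have hP0 : P ≠ 0 := (ENNReal.div_pos (critExp'_ne_zero hN) ENNReal.ofReal_ne_top).ne'
  have hPt : P ≠ ⊤ := ENNReal.div_ne_top critExp'_ne_top (by
    rw [ne_eq, ENNReal.ofReal_eq_zero]; linarith)
  have hm : ∀ r : ℝ, AEStronglyMeasurable (fun x : Euc N => r * (‖x‖⁻¹) ^ 2) volume := fun r =>
    Measurable.aestronglyMeasurable (by fun_prop)
  -- The excess of `V` over `r |x|^{-2}` vanishes pointwise for large `r` (off the origin), hence
  -- tends to `0` in `L^{N/2}`; the truncated rest is charged to the Hardy term.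
  set g : ℝ → Euc N → ℝ := fun r x => V x - min (V x) (r * (‖x‖⁻¹) ^ 2)
  have hgm : ∀ r, AEStronglyMeasurable (g r) volume := fun r => hV.1.sub (hV.1.inf (hm r))
  have hg0 : ∀ r x, 0 ≤ g r x := fun r x => sub_nonneg.2 (min_le_left _ _)
  have hgV : ∀ r, 0 ≤ r → ∀ x, ‖g r x‖ ≤ ‖V x‖ := fun r hr x => by
    rw [Real.norm_of_nonneg (hg0 r x), Real.norm_of_nonneg (hV0 x)]
    exact sub_le_self _ (le_min (hV0 x) (by positivity))
  have : Nontrivial (Euc N) := by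
    have : Nonempty (Fin N) := ⟨⟨0, by omega⟩⟩
    infer_instance
  have hlim : Tendsto (fun r : ℝ => eLpNorm (g r) P volume) atTop (𝓝 0) := by
    refine tendsto_eLpNorm_zero_of_dominated hP0 hPt hV (Eventually.of_forall hgm) ?_ ?_
    · filter_upwards [eventually_ge_atTop 0] with r hr x
      exact enorm_le_iff_norm_le.2 (hgV r hr x)
    · filter_upwards [compl_mem_ae_iff.2 (measure_singleton (0 : Euc N))] with x hx
      have hx' : 0 < ‖x‖ := norm_pos_iff.2 hx
      filter_upwards [eventually_ge_atTop (V x * ‖x‖ ^ 2)] with r hr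
      have : V x ≤ r * (‖x‖⁻¹) ^ 2 := by
        rw [inv_pow, ← div_eq_mul_inv, le_div_iff₀ (by positivity)]; exact hr
      simp only [g]
      rw [min_eq_left this, sub_self]
  obtain ⟨r, hr, hr0⟩ := ((hlim.eventually (gt_mem_nhds (ENNReal.ofReal_pos.2 hε))).and
    (eventually_ge_atTop 0)).exists
  have hgL : MemLp (g r) P volume := hV.mono (hgm r) (Eventually.of_forall (hgV r hr0))
  refine ⟨r, hr0, fun w hw hwx => ?_⟩
  obtain ⟨i1, b1⟩ := integral_mul_sq_le hN hgL hw
  obtain ⟨i2, b2⟩ := integral_sq_le hwx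
  have hr' : (eLpNorm (g r) P volume).toReal ≤ ε := by
    have := ENNReal.toReal_mono ENNReal.ofReal_ne_top hr.le
    rwa [ENNReal.toReal_ofReal hε.le] at this
  calc ∫ x, V x * w x ^ 2 ≤ ∫ x, (g r x * w x ^ 2 + r * (‖x‖⁻¹ * w x) ^ 2) := by
        refine integral_mono (integral_mul_sq_le hN hV hw).1 (i1.add (i2.const_mul r)) fun x => ?_
        have : V x ≤ g r x + r * (‖x‖⁻¹) ^ 2 := by
          have := min_le_right (V x) (r * (‖x‖⁻¹) ^ 2)
          simp only [g]; linarith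
        calc V x * w x ^ 2 ≤ (g r x + r * (‖x‖⁻¹) ^ 2) * w x ^ 2 := by gcongr
          _ = _ := by ring
    _ = (∫ x, g r x * w x ^ 2) + r * ∫ x, (‖x‖⁻¹ * w x) ^ 2 := by
        rw [integral_add i1 (i2.const_mul r), integral_const_mul]
    _ ≤ _ := by
        refine add_le_add (b1.trans ?_) ?_
        · gcongr
        · gcongr

end Potential

/-! ### Dilation differences and their behaviour under `s ↦ -s`. -/

section Differences

variable {N : ℕ}

/-- The difference between the dilation `u_s` and `u`. -/
noncomputable def dilDiff (s : ℝ) (u : Euc N → ℝ) : Euc N → ℝ := dil (((N : ℝ) - 2) / 2) s u - u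

/-- The gradient of `dilDiff s u`. -/
noncomputable def gradDiff (s : ℝ) (Du : Euc N → Euc N) : Euc N → Euc N := dil ((N : ℝ) / 2) s Du - Du

/-- The `L^2` norm of `gradDiff s Du`. -/
noncomputable def gradDiffNorm (s : ℝ) (Du : Euc N → Euc N) : ℝ :=
  (eLpNorm (gradDiff s Du) 2 volume).toReal

/-- The integrand controlling the nonlinear terms. -/
noncomputable def powDiff (s : ℝ) (v u : Euc N → ℝ) : Euc N → ℝ := fun x =>
  |dil (((N : ℝ) - 2) / 2) s v x ^ (critExp N - 1) - v x ^ (critExp N - 1)| * |dilDiff s u x|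

theorem dilDiff_neg (s : ℝ) (u : Euc N → ℝ) :
    dilDiff (-s) u = -dil (((N : ℝ) - 2) / 2) (-s) (dilDiff s u) := by
  rw [dilDiff, dilDiff, dil_sub, dil_dil, neg_add_cancel, dil_zero, neg_sub]

theorem gradDiff_neg (s : ℝ) (Du : Euc N → Euc N) :
    gradDiff (-s) Du = -dil ((N : ℝ) / 2) (-s) (gradDiff s Du) := by
  rw [gradDiff, gradDiff, dil_sub, dil_dil, neg_add_cancel, dil_zero, neg_sub]

theorem gradDiffNorm_neg (s : ℝ) (Du : Euc N → Euc N) :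
    gradDiffNorm (-s) Du = gradDiffNorm s Du := by
  rw [gradDiffNorm, gradDiff_neg, eLpNorm_neg, eLpNorm_dil _ (by norm_num) (by norm_num) (by simp),
    gradDiffNorm]

theorem integrable_inner {F G : Euc N → Euc N} (hF : MemLp F 2 volume) (hG : MemLp G 2 volume) :
    Integrable (fun x => inner ℝ (F x) (G x)) volume := by
  refine (integrable_mul_of_memLp hF.norm hG.norm).mono' (hF.1.inner hG.1)
    (Eventually.of_forall fun x => norm_inner_le_norm _ _)

theorem abs_integral_inner_le {F G : Euc N → Euc N} (hF : MemLp F 2 volume) (hG : MemLp G 2 volume) :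
    |∫ x, inner ℝ (F x) (G x)| ≤ (eLpNorm F 2 volume).toReal * (eLpNorm G 2 volume).toReal := by
  have h := (le_abs_self _).trans (abs_integral_mul_le hF.norm hG.norm)
  rw [eLpNorm_norm, eLpNorm_norm] at h
  refine le_trans ?_ h
  rw [← Real.norm_eq_abs]
  refine (norm_integral_le_integral_norm _).trans (integral_mono (integrable_inner hF hG).norm
    (integrable_mul_of_memLp hF.norm hG.norm) fun x => norm_inner_le_norm _ _)

theorem integral_inner_self {F : Euc N → Euc N} (hF : MemLp F 2 volume) :
    ∫ x, inner ℝ (F x) (F x) = (eLpNorm F 2 volume).toReal ^ 2 := by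
  have h0 : 0 ≤ ∫ x, ‖F x‖ ^ (2 : ℝ) := integral_nonneg fun x => by positivity
  rw [hF.eLpNorm_eq_integral_rpow_norm (by norm_num) (by norm_num)]
  simp only [ENNReal.toReal_ofNat]
  rw [ENNReal.toReal_ofReal (by positivity), ← Real.rpow_natCast, ← Real.rpow_mul h0]
  norm_num [real_inner_self_eq_norm_sq]

theorem integral_inner_dil (s : ℝ) (F G : Euc N → Euc N) :
    ∫ x, inner ℝ (dil ((N : ℝ) / 2) s F x) (G x) = ∫ x, inner ℝ (F x) (dil ((N : ℝ) / 2) (-s) G x) := by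
  rw [← integral_dil (fun x => inner ℝ (F x) (dil ((N : ℝ) / 2) (-s) G x)) s]
  congr 1
  funext x
  have hG : G = dil ((N : ℝ) / 2) s (dil ((N : ℝ) / 2) (-s) G) := by
    rw [dil_dil, add_neg_cancel, dil_zero]
  conv_lhs => rw [hG]
  simp only [dil_apply, inner_smul_left, inner_smul_right, conj_trivial, smul_eq_mul]
  rw [show Real.exp ((N : ℝ) * s) = Real.exp ((N : ℝ) / 2 * s) * Real.exp ((N : ℝ) / 2 * s) by
    rw [← Real.exp_add]; ring_nf]
  ring

/-! ### Quadratic control of the power nonlinearity. -/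

section Potential

variable {u v : Euc N → ℝ} {Du Dv : Euc N → Euc N}

theorem TestLimit.dilDiff (h : TestLimit u Du) (s : ℝ) : TestLimit (dilDiff s u) (gradDiff s Du) :=
  (h.dil s).sub h

/-- Weight `2` for `V` and `N - 2` for the square add up to `N`, and dilating back turns the
difference at `s` into minus the difference at `-s`. Dilated potentials thus reduce to the fixed
one. -/
theorem integral_dil_mul_dilDiff_sq (V : Euc N → ℝ) (s : ℝ) :
    ∫ x, dil 2 s V x * dilDiff s u x ^ 2 = ∫ x, V x * dilDiff (-s) u x ^ 2 := by
  rw [integral_dil_mul s (show (2 : ℝ) + (N - 2) = N by ring)]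
  congr 1
  funext x
  rw [dilDiff_neg]
  simp only [dil_apply, Pi.neg_apply, smul_eq_mul, neg_sq, mul_pow, ← Real.exp_nat_mul]
  congr 3
  push_cast; ring

theorem integrable_dil_mul_dilDiff_sq {V : Euc N → ℝ} {s : ℝ}
    (h : Integrable (fun x => V x * _root_.dilDiff (-s) u x ^ 2) volume) :
    Integrable (fun x => dil 2 s V x * _root_.dilDiff s u x ^ 2) volume := by
  rw [integrable_dil_mul s (show (2 : ℝ) + (N - 2) = N by ring)]
  refine h.congr (Eventually.of_forall fun x => ?_)
  simp only [dilDiff_neg]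
  simp only [dil_apply, Pi.neg_apply, smul_eq_mul, neg_sq, mul_pow, ← Real.exp_nat_mul]
  congr 3
  push_cast; ring

/-- In the form bound, Sobolev turns the small term into the gradient difference, while the Hardy
term is `O(s²)` by the dilation estimate. -/
theorem TestLimit.exists_integral_potential_dilDiff_le (h : TestLimit u Du) (hN : 3 ≤ N)
    {V : Euc N → ℝ} (hV0 : ∀ x, 0 ≤ V x)
    (hV : MemLp V (critExp' N / ENNReal.ofReal (critExp N - 2)) volume) {ε : ℝ} (hε : 0 < ε) :
    ∃ K : ℝ, 0 ≤ K ∧ ∀ s : ℝ, N * |s| ≤ 1 →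
      ∫ x, V x * _root_.dilDiff s u x ^ 2 ≤ ε * gradDiffNorm s Du ^ 2 + K * s ^ 2 := by
  set S : ℝ := (sobolevConst N : ℝ≥0).toReal
  -- The squared Sobolev constant is compensated; `+ 1` avoids a division by zero.
  obtain ⟨K, hK, hw⟩ := exists_integral_potential_le hN hV0 hV (ε := ε / (S ^ 2 + 1)) (by positivity)
  set D := (eLpNorm Du 2 volume).toReal
  refine ⟨K * (dilConst N * D) ^ 2, by positivity, fun s hs => ?_⟩
  have hd := h.dilDiff s
  refine (hw _ (hd.memLp hN) (hd.memLp_inv_norm_mul hN)).trans (add_le_add ?_ ?_)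
  · have h1 := ENNReal.toReal_mono (ENNReal.mul_ne_top ENNReal.coe_ne_top hd.memLp_grad.2.ne)
      (hd.sobolev hN)
    rw [ENNReal.toReal_mul, ENNReal.coe_toReal] at h1
    calc _ ≤ ε / (S ^ 2 + 1) * (S * gradDiffNorm s Du) ^ 2 := by
          gcongr; exact h1
      _ = ε * gradDiffNorm s Du ^ 2 * (S ^ 2 / (S ^ 2 + 1)) := by ring
      _ ≤ ε * gradDiffNorm s Du ^ 2 * 1 := by
          gcongr
          rw [div_le_one (by positivity)]; linarith
      _ = _ := mul_one _
  · have h1 := ENNReal.toReal_mono (ENNReal.mul_ne_top ENNReal.ofReal_ne_top h.memLp_grad.2.ne)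
      (h.inv_norm_mul_dil_sub_le hN hs)
    rw [ENNReal.toReal_mul, ENNReal.toReal_ofReal
      (mul_nonneg (dilConst_nonneg N) (abs_nonneg s))] at h1
    calc _ ≤ K * (dilConst N * |s| * D) ^ 2 := by
          gcongr; exact h1
      _ = _ := by rw [mul_pow, mul_pow, sq_abs]; ring

theorem ae_dil_pos (hv : ∀ᵐ x, 0 < v x) (a s : ℝ) : ∀ᵐ x : Euc N, 0 < dil a s v x := by
  filter_upwards [ae_exp_smul hv s] with x hx
  exact mul_pos (Real.exp_pos _) hx

theorem TestLimit.aestronglyMeasurable_powDiff (hu : TestLimit u Du) (hv : TestLimit v Dv) (s : ℝ) :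
    AEStronglyMeasurable (powDiff s v u) volume := by
  have h1 := hv.aestronglyMeasurable.aemeasurable
  have h2 := (hv.dil s).aestronglyMeasurable.aemeasurable
  have h3 := (hu.dilDiff s).aestronglyMeasurable.aemeasurable
  exact (((h2.pow_const _).sub (h1.pow_const _)).norm.mul h3.norm).aestronglyMeasurable

/-- Pointwise, the difference of the powers is at most `(2^* - 1)(v^{2^*-2} + v_s^{2^*-2}) |v_s -
v|`; the arithmetic-geometric mean inequality separates `u` from `v`, and the terms with the dilated
potential are moved to `-s`. -/
theorem TestLimit.integrable_powDiff (hN : 3 ≤ N) (hu : TestLimit u Du) (hv : TestLimit v Dv)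
    (hpos : ∀ᵐ x, 0 < v x) (s : ℝ) : Integrable (powDiff s v u) volume ∧
    ∫ x, powDiff s v u x ≤ (critExp N - 1) / 2 *
      ((∫ x, |v x| ^ (critExp N - 2) * _root_.dilDiff s u x ^ 2) +
        (∫ x, |v x| ^ (critExp N - 2) * _root_.dilDiff s v x ^ 2) +
        ((∫ x, |v x| ^ (critExp N - 2) * _root_.dilDiff (-s) u x ^ 2) +
        (∫ x, |v x| ^ (critExp N - 2) * _root_.dilDiff (-s) v x ^ 2))) := by
  have hq := two_lt_critExp hN
  set V : Euc N → ℝ := fun x => |v x| ^ (critExp N - 2) with hVdef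
  have hV := memLp_norm_rpow_sub (hv.memLp hN) (critExp N - 2) (by linarith)
  have i1 : ∀ t, Integrable (fun x => V x * _root_.dilDiff t u x ^ 2) volume := fun t =>
    (integral_mul_sq_le hN hV ((hu.dilDiff t).memLp hN)).1
  have i2 : ∀ t, Integrable (fun x => V x * _root_.dilDiff t v x ^ 2) volume := fun t =>
    (integral_mul_sq_le hN hV ((hv.dilDiff t).memLp hN)).1
  have j1 := integrable_dil_mul_dilDiff_sq (i1 (-s))
  have j2 := integrable_dil_mul_dilDiff_sq (i2 (-s))
  have hI := (((i1 s).add (i2 s)).add (j1.add j2)).const_mul ((critExp N - 1) / 2)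
  -- The weight is `2` because `c (2^* - 2) = N - (N - 2)`.
  have hV2 : ∀ x, _root_.dil 2 s V x = |_root_.dil (((N : ℝ) - 2) / 2) s v x| ^ (critExp N - 2) := by
    intro x
    simp only [dil_apply, smul_eq_mul, hVdef, abs_mul, Real.abs_exp]
    rw [Real.mul_rpow (Real.exp_pos _).le (abs_nonneg _), ← Real.exp_mul]
    congr 2
    have := weight_mul_critExp hN
    linear_combination -s * this
  have hb : ∀ᵐ x, powDiff s v u x ≤ (critExp N - 1) / 2 * (V x * _root_.dilDiff s u x ^ 2 +
      V x * _root_.dilDiff s v x ^ 2 + (_root_.dil 2 s V x * _root_.dilDiff s u x ^ 2 +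
      _root_.dil 2 s V x * _root_.dilDiff s v x ^ 2)) := by
    filter_upwards [hpos, ae_dil_pos hpos (((N : ℝ) - 2) / 2) s] with x hx hx'
    have h1 := abs_rpow_sub_le hx hx' (p := critExp N - 1) (by linarith)
    rw [show critExp N - 1 - 1 = critExp N - 2 by ring] at h1
    rw [hV2, hVdef]
    simp only [abs_of_pos hx, abs_of_pos hx']
    set a := v x ^ (critExp N - 2)
    set b := _root_.dil (((N : ℝ) - 2) / 2) s v x ^ (critExp N - 2)
    have ha : 0 ≤ a := by positivity
    have hb : 0 ≤ b := by positivity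
    have e1 : _root_.dil (((N : ℝ) - 2) / 2) s v x - v x = _root_.dilDiff s v x := rfl
    rw [e1] at h1
    have h2 : |_root_.dilDiff s v x| * |_root_.dilDiff s u x| ≤
        (_root_.dilDiff s u x ^ 2 + _root_.dilDiff s v x ^ 2) / 2 := by
      rw [← sq_abs (_root_.dilDiff s u x), ← sq_abs (_root_.dilDiff s v x)]
      nlinarith [sq_nonneg (|_root_.dilDiff s u x| - |_root_.dilDiff s v x|)]
    have hc : 0 ≤ (critExp N - 1) * (a + b) := mul_nonneg (by linarith) (by linarith)
    calc powDiff s v u x ≤ (critExp N - 1) * (a + b) * |_root_.dilDiff s v x| *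
          |_root_.dilDiff s u x| := mul_le_mul_of_nonneg_right h1 (abs_nonneg _)
      _ = (critExp N - 1) * (a + b) * (|_root_.dilDiff s v x| * |_root_.dilDiff s u x|) := by ring
      _ ≤ (critExp N - 1) * (a + b) * ((_root_.dilDiff s u x ^ 2 + _root_.dilDiff s v x ^ 2) / 2) :=
        mul_le_mul_of_nonneg_left h2 hc
      _ = _ := by ring
  have hint : Integrable (powDiff s v u) volume := by
    refine hI.mono' (hu.aestronglyMeasurable_powDiff hv s) ?_
    filter_upwards [hb] with x hx
    have h0 : 0 ≤ powDiff s v u x := mul_nonneg (abs_nonneg _) (abs_nonneg _)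
    rw [Real.norm_of_nonneg h0]
    exact hx
  refine ⟨hint, (integral_mono_ae hint hI hb).trans (le_of_eq ?_)⟩
  rw [integral_const_mul, integral_add' ((i1 s).add (i2 s)) (j1.add j2), integral_add' (i1 s) (i2 s),
    integral_add' j1 j2, integral_dil_mul_dilDiff_sq, integral_dil_mul_dilDiff_sq]

theorem TestLimit.exists_integral_powDiff_le (hN : 3 ≤ N) (hu : TestLimit u Du) (hv : TestLimit v Dv)
    (hpos : ∀ᵐ x, 0 < v x) {ε : ℝ} (hε : 0 < ε) :
    ∃ K : ℝ, 0 ≤ K ∧ ∀ s : ℝ, N * |s| ≤ 1 → ∫ x, powDiff s v u x ≤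
      ε * (gradDiffNorm s Du ^ 2 + gradDiffNorm s Dv ^ 2) + K * s ^ 2 := by
  have hq := two_lt_critExp hN
  have hp : 0 < critExp N - 1 := by linarith
  have hV := memLp_norm_rpow_sub (hv.memLp hN) (critExp N - 2) (by linarith)
  have hV0 : ∀ x, 0 ≤ |v x| ^ (critExp N - 2) := fun x => by positivity
  obtain ⟨K₁, hK₁, h₁⟩ := hu.exists_integral_potential_dilDiff_le hN hV0 hV (div_pos hε hp)
  obtain ⟨K₂, hK₂, h₂⟩ := hv.exists_integral_potential_dilDiff_le hN hV0 hV (div_pos hε hp)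
  refine ⟨(critExp N - 1) * (K₁ + K₂), by positivity, fun s hs => ?_⟩
  have a1 := h₁ s hs
  have a2 := h₂ s hs
  have a3 := h₁ (-s) (by rwa [abs_neg])
  have a4 := h₂ (-s) (by rwa [abs_neg])
  rw [gradDiffNorm_neg, neg_sq] at a3 a4
  refine (hu.integrable_powDiff hN hv hpos s).2.trans ?_
  calc _ ≤ (critExp N - 1) / 2 *
      ((ε / (critExp N - 1) * gradDiffNorm s Du ^ 2 + K₁ * s ^ 2) +
        (ε / (critExp N - 1) * gradDiffNorm s Dv ^ 2 + K₂ * s ^ 2) +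
        ((ε / (critExp N - 1) * gradDiffNorm s Du ^ 2 + K₁ * s ^ 2) +
        (ε / (critExp N - 1) * gradDiffNorm s Dv ^ 2 + K₂ * s ^ 2))) := by gcongr
    _ = _ := by field_simp; ring

theorem TestLimit.memLp_rpow (hN : 3 ≤ N) (hv : TestLimit v Dv) (hpos : ∀ᵐ x, 0 < v x) :
    MemLp (fun x => v x ^ (critExp N - 1)) (critExp' N / ENNReal.ofReal (critExp N - 1)) volume := by
  have hq := two_lt_critExp hN
  refine (memLp_norm_rpow_sub (hv.memLp hN) (critExp N - 1) (by linarith)).ae_eq ?_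
  filter_upwards [hpos] with x hx
  rw [abs_of_pos hx]

theorem TestLimit.integrable_rpow_mul (hN : 3 ≤ N) (hv : TestLimit v Dv) (hpos : ∀ᵐ x, 0 < v x)
    {w : Euc N → ℝ} (hw : MemLp w (critExp' N) volume) :
    Integrable (fun x => v x ^ (critExp N - 1) * w x) volume := by
  have := holderConjugate_critExp' hN
  exact integrable_mul_of_memLp (hv.memLp_rpow hN hpos) hw

/-- Second differences of `u` against a power of `v`. -/
theorem TestLimit.abs_integral_rpow_mul_add_le (hN : 3 ≤ N) (hu : TestLimit u Du)
    (hv : TestLimit v Dv) (hpos : ∀ᵐ x, 0 < v x) (s : ℝ) :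
    |(∫ x, v x ^ (critExp N - 1) * _root_.dilDiff s u x) +
      ∫ x, v x ^ (critExp N - 1) * _root_.dilDiff (-s) u x| ≤ ∫ x, powDiff s v u x := by
  set c : ℝ := ((N : ℝ) - 2) / 2 with hc
  have hw := (hu.dilDiff s).memLp hN
  -- Moving the dilation onto the power of `v` turns the sum of the two integrals into one of a
  -- product of differences. The weights match because `c (2^* - 1) = N - c`.
  have e : ∫ x, v x ^ (critExp N - 1) * _root_.dilDiff (-s) u x =
      -∫ x, _root_.dil c s v x ^ (critExp N - 1) * _root_.dilDiff s u x := by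
    have h1 : ∫ x, _root_.dil c s v x ^ (critExp N - 1) * _root_.dilDiff s u x =
        ∫ x, _root_.dil (N - c) s (fun x => v x ^ (critExp N - 1)) x * _root_.dilDiff s u x := by
      refine integral_congr_ae ?_
      filter_upwards [ae_exp_smul hpos s] with x hx
      simp only [dil_apply, smul_eq_mul]
      rw [Real.mul_rpow (Real.exp_pos _).le hx.le, ← Real.exp_mul]
      congr 3
      have := weight_mul_critExp hN
      rw [← hc] at this
      linear_combination s * this
    rw [h1, integral_dil_mul s (show (N : ℝ) - c + c = N by ring), dilDiff_neg, ← integral_neg]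
    simp [hc]
  rw [e, ← sub_eq_add_neg, ← integral_sub (hv.integrable_rpow_mul hN hpos hw)
    ((hv.dil s).integrable_rpow_mul hN (ae_dil_pos hpos _ s) hw), ← Real.norm_eq_abs]
  refine (norm_integral_le_integral_norm _).trans (le_of_eq ?_)
  congr 1
  funext x
  rw [← sub_mul, norm_mul, Real.norm_eq_abs, Real.norm_eq_abs, abs_sub_comm]
  rfl

/-- The first order variation of the scale invariant integral `∫ v ^ 2^*`. -/
theorem TestLimit.abs_integral_rpow_mul_le (hN : 3 ≤ N) (hv : TestLimit v Dv)
    (hpos : ∀ᵐ x, 0 < v x) (s : ℝ) :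
    |∫ x, v x ^ (critExp N - 1) * _root_.dilDiff s v x| ≤ ∫ x, powDiff s v v x := by
  have hq := two_lt_critExp hN
  have hq0 : 0 < critExp N := by linarith
  set c : ℝ := ((N : ℝ) - 2) / 2 with hc
  have hvi : Integrable (fun x => v x ^ critExp N) volume := by
    refine (hv.integrable_rpow_mul hN hpos (hv.memLp hN)).congr ?_
    filter_upwards [hpos] with x hx
    rw [← Real.rpow_add_one hx.ne', sub_add_cancel]
  have hdil : (fun x => _root_.dil c s v x ^ critExp N) =ᵐ[volume]
      _root_.dil N s (fun x => v x ^ critExp N) := by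
    filter_upwards [ae_exp_smul hpos s] with x hx
    simp only [dil_apply, smul_eq_mul]
    rw [Real.mul_rpow (Real.exp_pos _).le hx.le, ← Real.exp_mul]
    congr 2
    have := weight_mul_critExp hN
    rw [← hc] at this
    linear_combination s * this
  have hdi : Integrable (fun x => _root_.dil c s v x ^ critExp N) volume :=
    (integrable_dil hvi _ _).congr hdil.symm
  have hz : (∫ x, _root_.dil c s v x ^ critExp N) = ∫ x, v x ^ critExp N := by
    rw [integral_congr_ae hdil, integral_dil]
  have hpi := hv.integrable_rpow_mul hN hpos ((hv.dilDiff s).memLp hN)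
  -- The two integrals of `2^*`-th powers are equal, so the first-order term is, up to sign, the
  -- integral of the convexity remainder.
  have e : ∫ x, (_root_.dil c s v x ^ critExp N - v x ^ critExp N -
      critExp N * (v x ^ (critExp N - 1) * _root_.dilDiff s v x)) =
      -(critExp N * ∫ x, v x ^ (critExp N - 1) * _root_.dilDiff s v x) := by
    have hsub : Integrable (fun x => _root_.dil c s v x ^ critExp N - v x ^ critExp N) volume :=
      hdi.sub hvi
    rw [integral_sub hsub (hpi.const_mul _), integral_sub hdi hvi, hz, sub_self, zero_sub,
      integral_const_mul]
  have hb := norm_integral_le_of_norm_le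
    (((hv.integrable_powDiff hN hv hpos s).1).const_mul (critExp N))
    (f := fun x => _root_.dil c s v x ^ critExp N - v x ^ critExp N -
      critExp N * (v x ^ (critExp N - 1) * _root_.dilDiff s v x)) (by
      filter_upwards [hpos, ae_dil_pos hpos c s] with x hx hx'
      exact abs_rpow_sub_sub_le hx hx' (by linarith))
  rw [e, norm_neg, norm_mul, Real.norm_of_nonneg hq0.le, integral_const_mul] at hb
  exact le_of_mul_le_mul_left hb hq0

end Potential

/-! ### Unitarity on gradients and the enlarged class of test functions. -/

theorem memLp_gradDiff {F : Euc N → Euc N} (hF : MemLp F 2 volume) (s : ℝ) :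
    MemLp (gradDiff s F) 2 volume :=
  (memLp_dil (by norm_num) (by norm_num) (by simp) hF).sub hF

/-- For the unitary dilation `U`, `U*(U - 1) = -(U⁻¹ - 1)`. A product of two differences becomes
terms linear in differences, to which the equation applies. -/
theorem integral_inner_gradDiff {F G : Euc N → Euc N} (hF : MemLp F 2 volume)
    (hG : MemLp G 2 volume) (s : ℝ) :
    ∫ x, inner ℝ (gradDiff s F x) (gradDiff s G x) =
      -(∫ x, inner ℝ (F x) (gradDiff (-s) G x)) - ∫ x, inner ℝ (F x) (gradDiff s G x) := by
  have hFs : MemLp (dil ((N : ℝ) / 2) s F) 2 volume :=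
    memLp_dil (by norm_num) (by norm_num) (by simp) hF
  have h1 : ∫ x, inner ℝ (gradDiff s F x) (gradDiff s G x) =
      (∫ x, inner ℝ (dil ((N : ℝ) / 2) s F x) (gradDiff s G x)) -
        ∫ x, inner ℝ (F x) (gradDiff s G x) := by
    rw [← integral_sub (integrable_inner hFs (memLp_gradDiff hG s))
      (integrable_inner hF (memLp_gradDiff hG s))]
    congr 1
    funext x
    rw [← inner_sub_left]; rfl
  rw [h1, integral_inner_dil, gradDiff_neg, ← integral_neg]
  simp

theorem integral_inner_gradDiff_neg {F G : Euc N → Euc N} (hF : MemLp F 2 volume)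
    (hG : MemLp G 2 volume) (s : ℝ) :
    ∫ x, inner ℝ (F x) (gradDiff (-s) G x) = ∫ x, inner ℝ (G x) (gradDiff s F x) := by
  have hd : ∀ {F : Euc N → Euc N}, MemLp F 2 volume → ∀ s, MemLp (dil ((N : ℝ) / 2) s F) 2 volume :=
    fun hF s => memLp_dil (by norm_num) (by norm_num) (by simp) hF
  have h1 : ∫ x, inner ℝ (F x) (gradDiff (-s) G x) =
      (∫ x, inner ℝ (F x) (dil ((N : ℝ) / 2) (-s) G x)) - ∫ x, inner ℝ (F x) (G x) := by
    rw [← integral_sub (integrable_inner hF (hd hG _)) (integrable_inner hF hG)]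
    congr 1
    funext x
    rw [← inner_sub_right]; rfl
  have h2 : ∫ x, inner ℝ (G x) (gradDiff s F x) =
      (∫ x, inner ℝ (dil ((N : ℝ) / 2) s F x) (G x)) - ∫ x, inner ℝ (F x) (G x) := by
    rw [← integral_sub (integrable_inner (hd hF _) hG) (integrable_inner hF hG)]
    congr 1
    funext x
    rw [← inner_sub_left, real_inner_comm]; rfl
  rw [h1, h2, integral_inner_dil]

theorem integral_inner_gradDiff_symm {F G : Euc N → Euc N} (hF : MemLp F 2 volume)
    (hG : MemLp G 2 volume) (s : ℝ) :
    ∫ x, inner ℝ (gradDiff s F x) (gradDiff s G x) =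
      -(∫ x, inner ℝ (G x) (gradDiff s F x)) - ∫ x, inner ℝ (F x) (gradDiff s G x) := by
  rw [integral_inner_gradDiff hF hG, integral_inner_gradDiff_neg hF hG]

theorem tendsto_of_abs_sub_le {a : ℕ → ℝ} {b C : ℝ} {d : ℕ → ℝ≥0∞} (hd : Tendsto d atTop (𝓝 0))
    (h : ∀ n, |a n - b| ≤ C * (d n).toReal) : Tendsto a atTop (𝓝 b) := by
  rw [tendsto_iff_norm_sub_tendsto_zero]
  refine squeeze_zero (fun n => norm_nonneg _) h ?_
  simpa using ((ENNReal.tendsto_toReal ENNReal.zero_ne_top).comp hd).const_mul C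

/-- A weak solution may be tested with every limit of test functions. -/
theorem IsWeakPoissonSolution.integral_inner_eq {ι : Type*} [Fintype ι] (hN : 3 ≤ N)
    {Du : Euc N → Euc N} (hDu : MemLp Du 2 volume) {v : ι → Euc N → ℝ} {Dv : ι → Euc N → Euc N}
    (hv : ∀ j, TestLimit (v j) (Dv j)) (hpos : ∀ j, ∀ᵐ x, 0 < v j x) {H : Euc N → ℝ}
    (hH : MemLp (fun x => ‖x‖ * H x) 2 volume) {a : ι → ℝ}
    (hsol : IsWeakPoissonSolution Du (fun x => (∑ j, a j * v j x ^ (critExp N - 1)) + H x))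
    {φ : Euc N → ℝ} {Dφ : Euc N → Euc N} (hφ : TestLimit φ Dφ) :
    ∫ x, inner ℝ (Du x) (Dφ x) =
      (∑ j, a j * ∫ x, v j x ^ (critExp N - 1) * φ x) + ∫ x, H x * φ x := by
  have htest : ∀ ψ, IsTest ψ → ∫ x, inner ℝ (Du x) (gradient ψ x) =
      (∑ j, a j * ∫ x, v j x ^ (critExp N - 1) * ψ x) + ∫ x, H x * ψ x := by
    intro ψ hψ
    have h1 := hsol.integral_eq ψ hψ.contDiff hψ.hasCompactSupport
    have h2 : ∀ x, inner ℝ (Du x) (gradient ψ x) = fderiv ℝ ψ x (Du x) := fun x => by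
      rw [inner_gradient_right]; simp
    have i1 : ∀ j, Integrable (fun x => a j * (v j x ^ (critExp N - 1) * ψ x)) volume := fun j =>
      ((hv j).integrable_rpow_mul hN (hpos j) (hψ.memLp _)).const_mul _
    have i2 := integrable_mul_of_weighted hN hH (hψ.testLimit.memLp_inv_norm_mul hN)
    simp_rw [h2]
    rw [h1]
    simp_rw [← integral_const_mul]
    rw [← integral_finsetSum _ fun j _ => i1 j, ← integral_add (integrable_finsetSum _ fun j _ => i1 j) i2]
    congr 1
    funext x
    rw [add_mul, Finset.sum_mul]
    simp only [mul_assoc]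
  -- Each mode of convergence serves one term: `L^2` gradients the left side, `L^{2^*}` the powers,
  -- the weighted `L^2` norm the term with `H`.
  obtain ⟨ψ, p1, p2, p3, p4⟩ := hφ.exists_seq_tendsto hN
  have hsub : ∀ n, TestLimit (ψ n - φ) (gradient (ψ n) - Dφ) := fun n => (p1 n).testLimit.sub hφ
  have l1 : Tendsto (fun n => ∫ x, inner ℝ (Du x) (gradient (ψ n) x)) atTop
      (𝓝 (∫ x, inner ℝ (Du x) (Dφ x))) := by
    refine tendsto_of_abs_sub_le p4 (C := (eLpNorm Du 2 volume).toReal) fun n => ?_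
    rw [← integral_sub (integrable_inner hDu ((p1 n).memLp_gradient 2))
      (integrable_inner hDu hφ.memLp_grad)]
    simp_rw [← inner_sub_right]
    exact abs_integral_inner_le hDu (hsub n).memLp_grad
  have l2 : ∀ j, Tendsto (fun n => ∫ x, v j x ^ (critExp N - 1) * ψ n x) atTop
      (𝓝 (∫ x, v j x ^ (critExp N - 1) * φ x)) := by
    intro j
    have := holderConjugate_critExp' hN
    have hvj := (hv j).memLp_rpow hN (hpos j)
    refine tendsto_of_abs_sub_le p2 (C := (eLpNorm (fun x => v j x ^ (critExp N - 1))
      (critExp' N / ENNReal.ofReal (critExp N - 1)) volume).toReal) fun n => ?_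
    rw [← integral_sub (integrable_mul_of_memLp (q := critExp' N) hvj ((p1 n).memLp _))
      (integrable_mul_of_memLp hvj (hφ.memLp hN))]
    simp_rw [← mul_sub]
    exact abs_integral_mul_le hvj ((hsub n).memLp hN)
  have l3 : Tendsto (fun n => ∫ x, H x * ψ n x) atTop (𝓝 (∫ x, H x * φ x)) := by
    refine tendsto_of_abs_sub_le p3 (C := (eLpNorm (fun x => ‖x‖ * H x) 2 volume).toReal) fun n => ?_
    rw [← integral_sub
      (integrable_mul_of_weighted hN hH ((p1 n).testLimit.memLp_inv_norm_mul hN))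
      (integrable_mul_of_weighted hN hH (hφ.memLp_inv_norm_mul hN))]
    simp_rw [← mul_sub]
    exact abs_integral_mul_le_weighted hN hH ((hsub n).memLp_inv_norm_mul hN)
  refine tendsto_nhds_unique l1 ?_
  simp_rw [fun n => htest _ (p1 n)]
  exact (tendsto_finsetSum _ fun j _ => (l2 j).const_mul _).add l3

/-! ### Estimates for the system. -/

section System

variable {k : ℕ} {A : Matrix (Fin k) (Fin k) ℝ} {u : Fin k → Euc N → ℝ}
  {Du : Fin k → Euc N → Euc N} {H : Fin k → Euc N → ℝ}

theorem powDiff_integral_nonneg (s : ℝ) (v u : Euc N → ℝ) : 0 ≤ ∫ x, powDiff s v u x :=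
  integral_nonneg fun _ => mul_nonneg (abs_nonneg _) (abs_nonneg _)

theorem sum_sum_powDiff_le (hN : 3 ≤ N) (hu : ∀ i, TestLimit (u i) (Du i))
    (hpos : ∀ i, ∀ᵐ x, 0 < u i x) {ε : ℝ} (hε : 0 < ε) :
    ∃ K : ℝ, 0 ≤ K ∧ ∀ s : ℝ, N * |s| ≤ 1 → ∑ i, ∑ j, ∫ x, powDiff s (u j) (u i) x ≤
      ε * (∑ i, gradDiffNorm s (Du i) ^ 2) + K * s ^ 2 := by
  -- Each of the `k²` pairs contributes at most `2 δ Q`.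
  set δ : ℝ := ε / (2 * (k * k) + 1) with hδ
  have hδ0 : 0 < δ := by positivity
  choose K hK0 hK using fun i j => (hu i).exists_integral_powDiff_le hN (hu j) (hpos j) hδ0
  refine ⟨∑ i, ∑ j, K i j, Finset.sum_nonneg fun i _ => Finset.sum_nonneg fun j _ => hK0 i j,
    fun s hs => ?_⟩
  set Q := ∑ i, gradDiffNorm s (Du i) ^ 2
  have hQ : ∀ i, gradDiffNorm s (Du i) ^ 2 ≤ Q := fun i =>
    Finset.single_le_sum (f := fun i => gradDiffNorm s (Du i) ^ 2) (fun j _ => sq_nonneg _)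
      (Finset.mem_univ i)
  have hQ0 : 0 ≤ Q := Finset.sum_nonneg fun i _ => sq_nonneg _
  calc _ ≤ ∑ i, ∑ j, (δ * (Q + Q) + K i j * s ^ 2) := by
        refine Finset.sum_le_sum fun i _ => Finset.sum_le_sum fun j _ => (hK i j s hs).trans ?_
        have := hQ i; have := hQ j
        gcongr
    _ = (2 * (k * k)) / (2 * (k * k) + 1) * (ε * Q) + (∑ i, ∑ j, K i j) * s ^ 2 := by
        simp only [Finset.sum_add_distrib, Finset.sum_const, Finset.card_univ, Fintype.card_fin,
          nsmul_eq_mul, Finset.sum_mul]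
        rw [hδ]; ring
    _ ≤ 1 * (ε * Q) + (∑ i, ∑ j, K i j) * s ^ 2 := by
        gcongr
        rw [div_le_one (by positivity)]; linarith
    _ = _ := by rw [one_mul]

/-- The squared gradient difference is minus the pairing of `Du i` with the sum of the differences
at `s` and `-s`, which the equation turns into second differences of the powers and of the `H`
terms. -/
theorem sum_gradDiffNorm_sq_le (hN : 3 ≤ N) (hu : ∀ i, TestLimit (u i) (Du i))
    (hpos : ∀ i, ∀ᵐ x, 0 < u i x) (hH : ∀ i, MemLp (fun x => ‖x‖ * H i x) 2 volume)
    (hsol : ∀ i, IsWeakPoissonSolution (Du i)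
      (fun x => (∑ j, A i j * u j x ^ (critExp N - 1)) + H i x)) (s : ℝ) :
    ∑ i, gradDiffNorm s (Du i) ^ 2 ≤
      (∑ i, ∑ j, |A i j|) * (∑ i, ∑ j, ∫ x, powDiff s (u j) (u i) x) +
      ∑ i, |(∫ x, H i x * dilDiff s (u i) x) + ∫ x, H i x * dilDiff (-s) (u i) x| := by
  have hone : ∀ i, gradDiffNorm s (Du i) ^ 2 ≤ (∑ j, |A i j| * ∫ x, powDiff s (u j) (u i) x) +
      |(∫ x, H i x * dilDiff s (u i) x) + ∫ x, H i x * dilDiff (-s) (u i) x| := by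
    intro i
    have e1 := (hsol i).integral_inner_eq hN (hu i).memLp_grad hu hpos (hH i) ((hu i).dilDiff s)
    have e2 := (hsol i).integral_inner_eq hN (hu i).memLp_grad hu hpos (hH i) ((hu i).dilDiff (-s))
    have e3 := integral_inner_gradDiff (hu i).memLp_grad (hu i).memLp_grad s
    rw [integral_inner_self (memLp_gradDiff (hu i).memLp_grad s), e1, e2] at e3
    rw [gradDiffNorm, e3]
    have h4 : -∑ j, (A i j * (∫ x, u j x ^ (critExp N - 1) * dilDiff s (u i) x) +
        A i j * ∫ x, u j x ^ (critExp N - 1) * dilDiff (-s) (u i) x) ≤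
        ∑ j, |A i j| * ∫ x, powDiff s (u j) (u i) x := by
      rw [← Finset.sum_neg_distrib]
      refine Finset.sum_le_sum fun j _ => ?_
      rw [← mul_add]
      refine (neg_le_abs _).trans ?_
      rw [abs_mul]
      exact mul_le_mul_of_nonneg_left ((hu i).abs_integral_rpow_mul_add_le hN (hu j) (hpos j) s)
        (abs_nonneg _)
    have h5 := neg_le_abs ((∫ x, H i x * dilDiff s (u i) x) + ∫ x, H i x * dilDiff (-s) (u i) x)
    rw [Finset.sum_add_distrib] at h4
    linarith
  refine (Finset.sum_le_sum fun i _ => hone i).trans ?_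
  rw [Finset.sum_add_distrib]
  gcongr
  rw [Finset.sum_mul]
  refine Finset.sum_le_sum fun i _ => ?_
  rw [Finset.sum_mul]
  refine Finset.sum_le_sum fun j _ => mul_le_mul_of_nonneg_left ?_ (abs_nonneg _)
  exact (Finset.single_le_sum (f := fun j => ∫ x, powDiff s (u j) (u i) x)
    (fun j _ => powDiff_integral_nonneg _ _ _) (Finset.mem_univ j)).trans
    (Finset.single_le_sum (f := fun i => ∑ j, ∫ x, powDiff s (u j) (u i) x)
    (fun i _ => Finset.sum_nonneg fun j _ => powDiff_integral_nonneg _ _ _) (Finset.mem_univ i))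

/-- The core of the identity: every first-order contribution except the one of `H` is, by
invariance, of second order. -/
theorem abs_sum_inv_mul_integral_le (hN : 3 ≤ N) (hA : A.IsSymm) (hAinv : IsUnit A)
    (hu : ∀ i, TestLimit (u i) (Du i))
    (hpos : ∀ i, ∀ᵐ x, 0 < u i x) (hH : ∀ i, MemLp (fun x => ‖x‖ * H i x) 2 volume)
    (hsol : ∀ i, IsWeakPoissonSolution (Du i)
      (fun x => (∑ j, A i j * u j x ^ (critExp N - 1)) + H i x)) (s : ℝ) :
    |∑ i, ∑ j, A⁻¹ i j * ∫ x, H i x * dilDiff s (u j) x| ≤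
      (∑ i, ∑ j, |A⁻¹ i j|) * (∑ i, gradDiffNorm s (Du i) ^ 2) +
      ∑ i, ∑ j, ∫ x, powDiff s (u j) (u i) x := by
  have hB : ∀ i j, A⁻¹ i j = A⁻¹ j i := fun i j => by
    have : (A⁻¹).transpose = A⁻¹ := by rw [Matrix.transpose_nonsing_inv, hA.eq]
    exact congrFun (congrFun this j) i
  have hBA : A⁻¹ * A = 1 := Matrix.nonsing_inv_mul A ((Matrix.isUnit_iff_isUnit_det A).1 hAinv)
  set Q := ∑ i, gradDiffNorm s (Du i) ^ 2
  set X : Fin k → Fin k → ℝ := fun i j => ∫ x, inner ℝ (Du i x) (gradDiff s (Du j) x) with hX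
  set Y : Fin k → Fin k → ℝ := fun l j => ∫ x, u l x ^ (critExp N - 1) * dilDiff s (u j) x with hY
  have e1 : ∀ i j, X i j = (∑ l, A i l * Y l j) + ∫ x, H i x * dilDiff s (u j) x := fun i j =>
    (hsol i).integral_inner_eq hN (hu i).memLp_grad hu hpos (hH i) ((hu j).dilDiff s)
  -- Contracting with the inverse removes the coupling and leaves the diagonal terms, each a first
  -- variation of an invariant integral.
  have e2 : ∑ i, ∑ j, A⁻¹ i j * (∑ l, A i l * Y l j) = ∑ j, Y j j := by
    rw [Finset.sum_comm]
    refine Finset.sum_congr rfl fun j _ => ?_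
    calc ∑ i, A⁻¹ i j * (∑ l, A i l * Y l j) = ∑ l, (∑ i, A⁻¹ j i * A i l) * Y l j := by
          simp_rw [Finset.mul_sum, Finset.sum_mul]
          rw [Finset.sum_comm]
          refine Finset.sum_congr rfl fun l _ => Finset.sum_congr rfl fun i _ => ?_
          rw [hB i j]; ring
      _ = ∑ l, (1 : Matrix (Fin k) (Fin k) ℝ) j l * Y l j := by
          simp_rw [← hBA, Matrix.mul_apply]
      _ = Y j j := by simp [Matrix.one_apply]
  have e3 : ∑ i, ∑ j, A⁻¹ i j * X i j = (∑ j, Y j j) +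
      ∑ i, ∑ j, A⁻¹ i j * ∫ x, H i x * dilDiff s (u j) x := by
    simp_rw [e1, mul_add, Finset.sum_add_distrib]
    rw [e2]
  -- Symmetry of `A⁻¹` identifies the two cross terms, hence the factor `-2`.
  have e4 : ∑ i, ∑ j, A⁻¹ i j * ∫ x, inner ℝ (gradDiff s (Du i) x) (gradDiff s (Du j) x) =
      -2 * ∑ i, ∑ j, A⁻¹ i j * X i j := by
    simp_rw [fun i j => integral_inner_gradDiff_symm (hu i).memLp_grad (hu j).memLp_grad s, mul_sub,
      mul_neg, Finset.sum_sub_distrib, Finset.sum_neg_distrib]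
    have : ∑ i, ∑ j, A⁻¹ i j * X j i = ∑ i, ∑ j, A⁻¹ i j * X i j := by
      rw [Finset.sum_comm]
      exact Finset.sum_congr rfl fun i _ => Finset.sum_congr rfl fun j _ => by rw [hB]
    rw [this]; ring
  have hQ : ∀ i, gradDiffNorm s (Du i) ^ 2 ≤ Q := fun i =>
    Finset.single_le_sum (f := fun i => gradDiffNorm s (Du i) ^ 2) (fun j _ => sq_nonneg _)
      (Finset.mem_univ i)
  have b1 : |∑ i, ∑ j, A⁻¹ i j * ∫ x, inner ℝ (gradDiff s (Du i) x) (gradDiff s (Du j) x)| ≤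
      (∑ i, ∑ j, |A⁻¹ i j|) * Q := by
    rw [Finset.sum_mul]
    refine (Finset.abs_sum_le_sum_abs _ _).trans (Finset.sum_le_sum fun i _ => ?_)
    rw [Finset.sum_mul]
    refine (Finset.abs_sum_le_sum_abs _ _).trans (Finset.sum_le_sum fun j _ => ?_)
    rw [abs_mul]
    refine mul_le_mul_of_nonneg_left ?_ (abs_nonneg _)
    refine (abs_integral_inner_le (memLp_gradDiff (hu i).memLp_grad s)
      (memLp_gradDiff (hu j).memLp_grad s)).trans ?_
    change gradDiffNorm s (Du i) * gradDiffNorm s (Du j) ≤ Q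
    nlinarith [hQ i, hQ j, sq_nonneg (gradDiffNorm s (Du i) - gradDiffNorm s (Du j))]
  have b2 : |∑ j, Y j j| ≤ ∑ i, ∑ j, ∫ x, powDiff s (u j) (u i) x := by
    refine (Finset.abs_sum_le_sum_abs _ _).trans (Finset.sum_le_sum fun j _ => ?_)
    refine ((hu j).abs_integral_rpow_mul_le hN (hpos j) s).trans ?_
    exact Finset.single_le_sum (f := fun l => ∫ x, powDiff s (u l) (u j) x)
      (fun l _ => powDiff_integral_nonneg _ _ _) (Finset.mem_univ j)
  have hnn : 0 ≤ (∑ i, ∑ j, |A⁻¹ i j|) * Q := (abs_nonneg _).trans b1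
  rw [e4] at b1
  rw [abs_le] at b1 b2 ⊢
  constructor <;> linarith [b1.1, b1.2, b2.1, b2.2]

end System

end Differences

end

theorem proposition3p9 (N k : ℕ) (hN : 3 ≤ N)
    (A : Matrix (Fin k) (Fin k) ℝ) (hAsymm : A.IsSymm) (hAinv : IsUnit A)
    (u : Fin k → EuclideanSpace ℝ (Fin N) → ℝ)
    (Du : Fin k → EuclideanSpace ℝ (Fin N) → EuclideanSpace ℝ (Fin N))
    (H : Fin k → EuclideanSpace ℝ (Fin N) → ℝ)
    (hu : ∀ i, MemD12 (u i) (Du i))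
    (hpos : ∀ i, ∀ᵐ x ∂(volume : Measure (EuclideanSpace ℝ (Fin N))), 0 < u i x)
    (hHsmooth : ∀ i, ContDiff ℝ ∞ (H i))
    (hHcrit : ∀ i, MemLp (H i) (ENNReal.ofReal (critExp N)) volume)
    (hHweight : ∀ i, MemLp (fun x => ‖x‖ * H i x) 2 volume)
    (hsol : ∀ i, IsWeakPoissonSolution (Du i)
      (fun x => (∑ j, A i j * u j x ^ (critExp N - 1)) + H i x)) :
    (∀ i j, Integrable
      (fun x => H i x * (inner ℝ x (Du j x) + ((N : ℝ) - 2) / 2 * u j x)) volume) ∧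
    0 = ∑ i, ∑ j, A⁻¹ i j *
      ∫ x, H i x * (inner ℝ x (Du j x) + ((N : ℝ) - 2) / 2 * u j x) := by
  have hT : ∀ i, TestLimit (u i) (Du i) := fun i => (hu i).testLimit hN
  refine ⟨fun i j => integrable_mul_of_weighted hN (hHweight i)
    ((hT j).memLp_inv_norm_mul_dilGen hN).1, ?_⟩
  have hlim : ∀ i j, Filter.Tendsto (fun s : ℝ => s⁻¹ * ∫ x, H i x * dilDiff s (u j) x)
      (nhdsWithin 0 {0}ᶜ) (nhds (∫ x, H i x * dilGen (u j) (Du j) x)) := fun i j =>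
    (hT j).tendsto_integral_dil_sub hN (hHsmooth i).continuous.locallyIntegrable (hHweight i)
  have hneg : Filter.Tendsto (fun s : ℝ => -s) (nhdsWithin 0 {0}ᶜ) (nhdsWithin 0 {0}ᶜ) := by
    refine tendsto_nhdsWithin_iff.2 ⟨?_, ?_⟩
    · have : Filter.Tendsto (fun s : ℝ => -s) (nhds 0) (nhds (-0)) := continuous_neg.tendsto 0
      rw [neg_zero] at this
      exact this.mono_left nhdsWithin_le_nhds
    · filter_upwards [self_mem_nhdsWithin] with s hs
      simpa using hs
  set R : ℝ → ℝ := fun s =>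
    ∑ i, |(∫ x, H i x * dilDiff s (u i) x) + ∫ x, H i x * dilDiff (-s) (u i) x| with hR
  -- Each summand is the absolute difference of the quotients at `s` and at `-s`, which share a
  -- limit.
  have hRlim : Filter.Tendsto (fun s : ℝ => |s|⁻¹ * R s) (nhdsWithin 0 {0}ᶜ) (nhds 0) := by
    have h1 : ∀ i, Filter.Tendsto (fun s : ℝ => |s|⁻¹ *
        |(∫ x, H i x * dilDiff s (u i) x) + ∫ x, H i x * dilDiff (-s) (u i) x|)
        (nhdsWithin 0 {0}ᶜ) (nhds 0) := by
      intro i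
      have h2 := ((hlim i i).sub ((hlim i i).comp hneg)).abs
      rw [sub_self, abs_zero] at h2
      refine h2.congr fun s => ?_
      simp only [Function.comp_apply]
      rw [inv_neg, neg_mul, sub_neg_eq_add, ← mul_add, abs_mul, abs_inv]
    have h3 := tendsto_finsetSum Finset.univ fun i _ => h1 i
    simp only [Finset.sum_const_zero] at h3
    refine h3.congr fun s => ?_
    rw [hR, Finset.mul_sum]
  set a : ℝ := ∑ i, ∑ j, |A i j|
  set b : ℝ := ∑ i, ∑ j, |A⁻¹ i j|
  have ha : 0 ≤ a := Finset.sum_nonneg fun i _ => Finset.sum_nonneg fun j _ => abs_nonneg _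
  have hb : 0 ≤ b := Finset.sum_nonneg fun i _ => Finset.sum_nonneg fun j _ => abs_nonneg _
  -- This `ε` gives `a ε ≤ 1/2`, so that `Q` can be absorbed, and also `ε ≤ 1`.
  obtain ⟨K, hK0, hK⟩ := sum_sum_powDiff_le hN hT hpos (ε := 1 / (2 * (a + 1))) (by positivity)
  set Z : ℝ → ℝ := fun s => ∑ i, ∑ j, A⁻¹ i j * ∫ x, H i x * dilDiff s (u j) x with hZ
  have hbound : ∀ s : ℝ, N * |s| ≤ 1 →
      |Z s| ≤ ((b + 1) * (2 * a * K) + K) * s ^ 2 + (b + 1) * 2 * R s := by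
    intro s hs
    have h1 := hK s hs
    have h2 := sum_gradDiffNorm_sq_le hN hT hpos hHweight hsol s
    have h3 := abs_sum_inv_mul_integral_le hN hAsymm hAinv hT hpos hHweight hsol s
    have hQ0 : 0 ≤ ∑ i, gradDiffNorm s (Du i) ^ 2 := Finset.sum_nonneg fun i _ => sq_nonneg _
    change |Z s| ≤ _ at h3
    change _ ≤ a * _ + R s at h2
    set Q := ∑ i, gradDiffNorm s (Du i) ^ 2
    set P := ∑ i, ∑ j, ∫ x, powDiff s (u j) (u i) x
    have h4 : a * (1 / (2 * (a + 1)) * Q) ≤ Q / 2 := by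
      have : a * (1 / (2 * (a + 1)) * Q) = a / (a + 1) * (Q / 2) := by field_simp
      rw [this]
      exact mul_le_of_le_one_left (by positivity) ((div_le_one (by positivity)).2 (by linarith))
    have h5 : 1 / (2 * (a + 1)) * Q ≤ Q :=
      mul_le_of_le_one_left hQ0 ((div_le_one (by positivity)).2 (by linarith))
    -- Absorption: `Q ≤ a P + R ≤ Q/2 + a K s² + R`.
    have h6 : Q ≤ 2 * (a * K * s ^ 2 + R s) := by
      have := mul_le_mul_of_nonneg_left h1 ha
      linarith
    have h7 := mul_le_mul_of_nonneg_left h6 hb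
    linarith
  have hZ0 : Filter.Tendsto (fun s : ℝ => s⁻¹ * Z s) (nhdsWithin 0 {0}ᶜ) (nhds 0) := by
    have hs0 : Filter.Tendsto (fun s : ℝ => |s|) (nhdsWithin 0 {0}ᶜ) (nhds 0) := by
      have : Filter.Tendsto (fun s : ℝ => |s|) (nhds 0) (nhds |0|) := continuous_abs.tendsto 0
      rw [abs_zero] at this
      exact this.mono_left nhdsWithin_le_nhds
    have hsmall : ∀ᶠ s : ℝ in nhdsWithin 0 {0}ᶜ, N * |s| ≤ 1 := by
      have := hs0.const_mul (N : ℝ)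
      rw [mul_zero] at this
      exact (this.eventually (gt_mem_nhds one_pos)).mono fun s hs => hs.le
    have hmaj := (hs0.const_mul ((b + 1) * (2 * a * K) + K)).add (hRlim.const_mul ((b + 1) * 2))
    simp only [mul_zero, add_zero] at hmaj
    refine squeeze_zero_norm' ?_ hmaj
    filter_upwards [hsmall, self_mem_nhdsWithin] with s hs hs1
    have hs2 : |s| ≠ 0 := abs_ne_zero.2 hs1
    rw [norm_mul, norm_inv, Real.norm_eq_abs, Real.norm_eq_abs]
    calc _ ≤ |s|⁻¹ * (((b + 1) * (2 * a * K) + K) * s ^ 2 + (b + 1) * 2 * R s) := by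
          gcongr; exact hbound s hs
      _ = _ := by
          rw [← sq_abs s]; field_simp
  have hZL : Filter.Tendsto (fun s : ℝ => s⁻¹ * Z s) (nhdsWithin 0 {0}ᶜ)
      (nhds (∑ i, ∑ j, A⁻¹ i j * ∫ x, H i x * dilGen (u j) (Du j) x)) := by
    have := tendsto_finsetSum Finset.univ fun i (_ : i ∈ Finset.univ) =>
      tendsto_finsetSum Finset.univ fun j (_ : j ∈ Finset.univ) => (hlim i j).const_mul (A⁻¹ i j)
    refine this.congr fun s => ?_
    rw [hZ, Finset.mul_sum]
    refine Finset.sum_congr rfl fun i _ => ?_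
    rw [Finset.mul_sum]
    exact Finset.sum_congr rfl fun j _ => by ring
  exact tendsto_nhds_unique hZ0 hZL
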